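/- **Setting.** Consider a connected network of $N$ agents with symmetric weighted adjacency matrix $A=[a_{k\ell}]$, $a_{k\ell}\ge 0$ (agents $k\ne\ell$ are joined by an edge iff $a_{k\ell}>0$), Laplacian $L=D-A$ with $D=\mathrm{diag}\{\sum_\ell a_{k\ell}\}$, and $\mathcal L=L\otimes I_M$. Each agent $k$ has a twice differentiable cost $J_k:\mathbb R^M\to\mathbb R$ with $0<\lambda_{k,\min}I_M\le\nabla^2J_k(w)\le\lambda_{k,\max}I_M$ for all $w$. For $\eta\ge0$ let $\mathcal W^o_\eta=\mathrm{col}\{w^o_{k,\eta}\}_{k=1}^N$ be the minimizer of $\sum_{k}J_k(w_k)+\frac{\eta}{2}\mathcal W^\top\mathcal L\mathcal W$ over $\mathcal W=\mathrm{col}\{w_k\}$, and assume that, for some $\kappa_d\ge0$, $\epsilon>0$, $\|\nabla^2J_k(w^o_{k,\eta}+\Delta)-\nabla^2J_k(w^o_{k,\eta})\|\le\kappa_d\|\Delta\|$ whenever $\|\Delta\|\le\epsilon$, for every $k$. With step-size $\mu>0$ and random approximate gradients $\widehat{\nabla J}_{k,i}(\cdot)$ (jointly measurable in the sample point and in $w$),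 the agents run, for $i\ge1$, $$\psi_{k,i}=w_{k,i-1}-\mu\,\widehat{\nabla J}_{k,i}(w_{k,i-1}),\qquad w_{k,i}=\psi_{k,i}-\mu\eta\sum_{\ell}a_{k\ell}(\psi_{k,i}-\psi_{\ell,i}),$$ from a random $\mathcal W_0$ with $\mathbb E\|\mathcal W_0\|^4<\infty$. Write $\mathcal W_i=\mathrm{col}\{w_{k,i}\}$, $\widetilde{\mathcal W}_i=\mathcal W^o_\eta-\mathcal W_i$, $s_{k,i}(w)=\nabla J_k(w)-\widehat{\nabla J}_{k,i}(w)$ and $s_i(\mathcal W)=\mathrm{col}\{s_{k,i}(w_k)\}$, and let $\mathcal F_{i-1}$ be the $\sigma$-algebra generated by $\mathcal W_0,\dots,\mathcal W_{i-1}$. Assume that, for all $i\ge1$, all agents $k\neq\ell$ and every $\mathcal F_{i-1}$-measurable random vector $w$ in $\mathbb R^M$, $$\mathbb E[s_{k,i}(w)\mid\mathcal F_{i-1}]=0,\quad \mathbb E[\|s_{k,i}(w)\|^2\mid\mathcal F_{i-1}]\le\beta_k^2\|w\|^2+\sigma_{s,k}^2,\quad \mathbb E[s_{k,i}(w)s_{\ell,i}(w)^\top\mid\mathcal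 F_{i-1}]=0,$$ $$\mathbb E[\|s_{k,i}(w)\|^4\mid\mathcal F_{i-1}]\le\overline\beta_k^4\|w\|^4+\overline\sigma_{s,k}^4,$$ where the two equalities to $0$ are only required when the random variables in them are integrable. Assume finally that $I_{MN}-\mu\eta\mathcal L$ has nonnegative entries and spectral radius one. Let $\mathcal H_\eta=\mathrm{diag}\{\nabla^2J_k(w^o_{k,\eta})\}_{k=1}^N$ and $\mathcal B_\eta=(I_{MN}-\mu\eta\mathcal L)(I_{MN}-\mu\mathcal H_\eta)$. The long-term model $\widetilde{\mathcal W}'_i$, started at some time $i_0\ge0$ from an arbitrary square-integrable random vector $\widetilde{\mathcal W}'_{i_0}$, is defined by $$\widetilde{\mathcal W}'_i=\mathcal B_\eta\widetilde{\mathcal W}'_{i-1}-\mu(I_{MN}-\mu\eta\mathcal L)s_i(\mathcal W_{i-1})+\mu^2\eta^2\mathcal L^2\mathcal W^o_\eta,\qquad i>i_0.$$ **Lemma (size of the approximation error).** As $\mu\to0$, $$\limsup_{i\to\infty}\mathbb E\|\widetilde{\mathcal W}_i-\widetilde{\mathcal W}'_i\|^2=O(\mu^2),\qquad \limsup_{i\to\infty}\mathbb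 E\|\widetilde{\mathcal W}_i\|^2=\limsup_{i\to\infty}\mathbb E\|\widetilde{\mathcal W}'_i\|^2+O(\mu^{3/2}),$$ both limits superior in the second relation being finite. That is, there are $C,\mu_0>0$, depending only on $A$, the costs $J_k$ and their bounds $\lambda_{k,\min},\lambda_{k,\max}$, the constants $\kappa_d,\epsilon$ and the noise constants $\beta_k,\sigma_{s,k},\overline\beta_k,\overline\sigma_{s,k}$, such that for all $\mu\in(0,\mu_0)$ and $\eta\ge0$ satisfying the assumptions above the first quantity is at most $C\mu^2$ and the two mean-square errors differ by at most $C\mu^{3/2}$ in absolute value. -/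

import Mathlib

open MeasureTheory ProbabilityTheory Filter
open scoped ENNReal

noncomputable section

/-- The parameter space `ℝ^M` of one agent, with the Euclidean norm. -/
abbrev Param (M : ℕ) : Type := EuclideanSpace ℝ (Fin M)

/-- Network block vectors `col {w_1, …, w_N}` with `w_k ∈ ℝ^M`, with the Euclidean norm of
`ℝ^(M N)`. -/
abbrev NetVec (N M : ℕ) : Type := PiLp 2 (fun _ : Fin N => Param M)

/-! ### The graph -/

/-- Two distinct agents are connected by an edge when the weight between them is positive. -/
def networkGraph {N : ℕ} (A : Matrix (Fin N) (Fin N) ℝ) (hA : A.IsSymm) :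
    SimpleGraph (Fin N) where
  Adj k l := k ≠ l ∧ 0 < A k l
  symm := ⟨fun k l h => ⟨h.1.symm, by rw [hA.apply]; exact h.2⟩⟩
  loopless := ⟨fun _ h => h.1 rfl⟩

/-- `A` is the symmetric nonnegative weighted adjacency matrix of a connected network. -/
structure IsNetwork {N : ℕ} (A : Matrix (Fin N) (Fin N) ℝ) : Prop where
  symm : A.IsSymm
  nonneg : ∀ k l, 0 ≤ A k l
  connected : (networkGraph A symm).Connected

/-- The graph Laplacian `L = D - A`, with `D` the diagonal matrix of the degrees `∑ₗ a_{kl}`. -/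
def laplacian {N : ℕ} (A : Matrix (Fin N) (Fin N) ℝ) : Matrix (Fin N) (Fin N) ℝ :=
  Matrix.diagonal (fun k => ∑ l, A k l) - A

/-- The operator `𝓛 = L ⊗ I_M` on network block vectors. -/
def bigLaplacian {N : ℕ} (M : ℕ) (A : Matrix (Fin N) (Fin N) ℝ) :
    Module.End ℝ (NetVec N M) where
  toFun w := WithLp.toLp 2 (fun k => ∑ l, laplacian A k l • w l)
  map_add' u w := by ext k : 1; simp [smul_add, Finset.sum_add_distrib]
  map_smul' c w := by ext k : 1; simp [Finset.smul_sum, smul_comm c]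

/-- The condition on the combination matrix `I_N - μ η L` (equivalently, on
`I_{MN} - μ η 𝓛 = (I_N - μ η L) ⊗ I_M`): its entries are nonnegative and its spectral radius
is one. -/
structure CombinationCondition {N : ℕ} (A : Matrix (Fin N) (Fin N) ℝ) (μ η : ℝ) : Prop where
  nonneg : ∀ k l, 0 ≤ (1 - (μ * η) • laplacian A : Matrix (Fin N) (Fin N) ℝ) k l
  spectralRadius_eq :
    spectralRadius ℝ (1 - (μ * η) • laplacian A : Matrix (Fin N) (Fin N) ℝ) = 1

/-! ### The costs -/

/-- The Hessian `∇²f(x)` as an operator: the derivative of the gradient. -/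
def hessian {M : ℕ} (f : Param M → ℝ) (x : Param M) : Param M →L[ℝ] Param M :=
  fderiv ℝ (gradient f) x

/-- The individual costs are twice differentiable, with Hessians uniformly bounded by
`0 < λ_{k,min} I ≤ ∇²J_k(w) ≤ λ_{k,max} I`. -/
structure StronglyConvexCosts {N M : ℕ} (J : Fin N → Param M → ℝ) (lmin lmax : Fin N → ℝ) :
    Prop where
  differentiable : ∀ k, Differentiable ℝ (J k)
  differentiable_gradient : ∀ k, Differentiable ℝ (gradient (J k))
  lmin_pos : ∀ k, 0 < lmin k
  lower : ∀ k w v, lmin k * ‖v‖ ^ 2 ≤ inner ℝ (hessian (J k) w v) v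
  upper : ∀ k w v, inner ℝ (hessian (J k) w v) v ≤ lmax k * ‖v‖ ^ 2

/-- The regularized global cost `∑ₖ J_k(w_k) + (η/2) wᵀ 𝓛 w`. -/
def globalCost {N M : ℕ} (A : Matrix (Fin N) (Fin N) ℝ) (J : Fin N → Param M → ℝ) (η : ℝ)
    (w : NetVec N M) : ℝ :=
  ∑ k, J k (w k) + η / 2 * inner ℝ w (bigLaplacian M A w)

/-- The Hessian of each `J_k` is Lipschitz at `w_k`, with constant `κ`, for perturbations of size
at most `ε`. -/
def HessianSmoothAt {N M : ℕ} (J : Fin N → Param M → ℝ) (w : NetVec N M) (κ ε : ℝ) : Prop :=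
  ∀ (k : Fin N) (Δ : Param M), ‖Δ‖ ≤ ε →
    ‖hessian (J k) (w k + Δ) - hessian (J k) (w k)‖ ≤ κ * ‖Δ‖

/-- The block diagonal operator `diag {∇²J_k(w_k)}`. -/
def bigHessian {N M : ℕ} (J : Fin N → Param M → ℝ) (w : NetVec N M) :
    Module.End ℝ (NetVec N M) where
  toFun v := WithLp.toLp 2 (fun k => hessian (J k) (w k) (v k))
  map_add' u v := by ext k : 1; simp
  map_smul' c v := by ext k : 1; simp

/-! ### The distributed strategy -/

/-- One iteration of the strategy, for a realization `g k` of the approximate gradients: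
`ψ_k = w_k - μ g_k(w_k)`, then `ψ_k - μ η ∑ₗ a_{kl} (ψ_k - ψ_l)`. -/
def diffusionStep {N M : ℕ} (A : Matrix (Fin N) (Fin N) ℝ) (μ η : ℝ)
    (g : Fin N → Param M → Param M) (w : NetVec N M) : NetVec N M :=
  let ψ : Fin N → Param M := fun k => w k - μ • g k (w k)
  WithLp.toLp 2 (fun k => ψ k - (μ * η) • ∑ l, A k l • (ψ k - ψ l))

/-- The random iterates, started from `w₀`. Here `g k i ω` is the approximate gradient of `J_k`
used at iteration `i ≥ 1`. -/
def iterates {N M : ℕ} {Ω : Type*} (A : Matrix (Fin N) (Fin N) ℝ) (μ η : ℝ)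
    (g : Fin N → ℕ → Ω → Param M → Param M) (w₀ : Ω → NetVec N M) : ℕ → Ω → NetVec N M
  | 0 => w₀
  | i + 1 => fun ω => diffusionStep A μ η (fun k => g k (i + 1) ω) (iterates A μ η g w₀ i ω)

/-- The σ-algebra generated by the random vectors `w_0, …, w_i`. -/
abbrev pastSigma {N M : ℕ} {Ω : Type*} (w : ℕ → Ω → NetVec N M) (i : ℕ) : MeasurableSpace Ω :=
  ⨆ j ≤ i, MeasurableSpace.comap (w j) inferInstance

/-- The gradient noise `s_{k,i}(x) = ∇J_k(x) - g_{k,i}(x)`. -/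
def gradientNoise {N M : ℕ} {Ω : Type*} (J : Fin N → Param M → ℝ)
    (g : Fin N → ℕ → Ω → Param M → Param M) (k : Fin N) (i : ℕ) (ω : Ω) (x : Param M) : Param M :=
  gradient (J k) x - g k i ω x

/-- The conditions on the gradient noise process relative to the past of the iterates `w`: at
iteration `i + 1` and for all `x` measurable with respect to the past `𝓕_i`, zero conditional mean,
conditional second and fourth moments bounded by `β_k² ‖x‖² + σ_k²` and `β4_k⁴ ‖x‖⁴ + σ4_k⁴`, and
uncorrelatedness across agents. The moments of norms are conditional expectations of
`[0, ∞]`-valued variables, so that the bounds include finiteness. -/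
structure NoiseConditions {N M : ℕ} {Ω : Type*} [MeasurableSpace Ω] (P : Measure Ω)
    (J : Fin N → Param M → ℝ) (g : Fin N → ℕ → Ω → Param M → Param M) (w : ℕ → Ω → NetVec N M)
    (β σ β4 σ4 : Fin N → ℝ) : Prop where
  mean : ∀ (k : Fin N) (i : ℕ) (x : Ω → Param M), Measurable[pastSigma w i] x →
    P[fun ω => gradientNoise J g k (i + 1) ω (x ω) | pastSigma w i] =ᵐ[P] 0
  second : ∀ (k : Fin N) (i : ℕ) (x : Ω → Param M), Measurable[pastSigma w i] x →
    P⁻[fun ω => ‖gradientNoise J g k (i + 1) ω (x ω)‖ₑ ^ 2 | pastSigma w i]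
      ≤ᵐ[P] fun ω => ENNReal.ofReal (β k ^ 2 * ‖x ω‖ ^ 2 + σ k ^ 2)
  uncorrelated : ∀ (k l : Fin N), k ≠ l → ∀ (i : ℕ) (x : Ω → Param M),
    Measurable[pastSigma w i] x → ∀ a b : Fin M,
    P[fun ω => gradientNoise J g k (i + 1) ω (x ω) a * gradientNoise J g l (i + 1) ω (x ω) b
      | pastSigma w i] =ᵐ[P] 0
  fourth : ∀ (k : Fin N) (i : ℕ) (x : Ω → Param M), Measurable[pastSigma w i] x →
    P⁻[fun ω => ‖gradientNoise J g k (i + 1) ω (x ω)‖ₑ ^ 4 | pastSigma w i]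
      ≤ᵐ[P] fun ω => ENNReal.ofReal (β4 k ^ 4 * ‖x ω‖ ^ 4 + σ4 k ^ 4)

/-- The noise block vector `s_i(w) = col {s_{k,i}(w_k)}`. -/
def noiseVec {N M : ℕ} {Ω : Type*} (J : Fin N → Param M → ℝ)
    (g : Fin N → ℕ → Ω → Param M → Param M) (i : ℕ) (ω : Ω) (w : NetVec N M) : NetVec N M :=
  WithLp.toLp 2 (fun k => gradientNoise J g k i ω (w k))

/-! ### The long-term model -/

/-- The constant matrix `𝓑_η = (I - μ η 𝓛) (I - μ 𝓗_η)`, where `𝓗_η = diag {∇²J_k(w_k)}` at the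
regularized solution `w = wη`. -/
def bigB {N M : ℕ} (A : Matrix (Fin N) (Fin N) ℝ) (J : Fin N → Param M → ℝ) (μ η : ℝ)
    (wη : NetVec N M) : Module.End ℝ (NetVec N M) :=
  (1 - (μ * η) • bigLaplacian M A) * (1 - μ • bigHessian J wη)

/-- One step of the long-term model, from the state `e` with noise vector `s`:
`𝓑_η e - μ (I - μ η 𝓛) s + μ² η² 𝓛² wη`. -/
def longTermStep {N M : ℕ} (A : Matrix (Fin N) (Fin N) ℝ) (J : Fin N → Param M → ℝ) (μ η : ℝ)
    (wη s e : NetVec N M) : NetVec N M :=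
  bigB A J μ η wη e - μ • (1 - (μ * η) • bigLaplacian M A : Module.End ℝ (NetVec N M)) s
    + (μ ^ 2 * η ^ 2) • (bigLaplacian M A ^ 2) wη

/-- The long-term model holds from time `i₀` on, driven by the gradient noise at the true
iterates `w`, from an arbitrary square-integrable state at time `i₀`. -/
structure IsLongTermModel {N M : ℕ} {Ω : Type*} [MeasurableSpace Ω] (P : Measure Ω)
    (A : Matrix (Fin N) (Fin N) ℝ) (J : Fin N → Param M → ℝ) (μ η : ℝ) (wη : NetVec N M)
    (g : Fin N → ℕ → Ω → Param M → Param M) (w : ℕ → Ω → NetVec N M) (i₀ : ℕ)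
    (e' : ℕ → Ω → NetVec N M) : Prop where
  init : MemLp (e' i₀) 2 P
  step : ∀ i, i₀ ≤ i → ∀ᵐ ω ∂P,
    e' (i + 1) ω = longTermStep A J μ η wη (noiseVec J g (i + 1) ω (w i ω)) (e' i ω)

/-- The asymptotic mean-square size `limsup_{i → ∞} E ‖X_i‖²`, in `[0, ∞]`. -/
def limsupMeanSq {N M : ℕ} {Ω : Type*} [MeasurableSpace Ω] (P : Measure Ω)
    (X : ℕ → Ω → NetVec N M) : ℝ≥0∞ :=
  limsup (fun i => ∫⁻ ω, ‖X i ω‖ₑ ^ 2 ∂P) atTop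

end

/-! Write `𝓒 = I - μη𝓛`. Its matrix has nonnegative entries and is doubly stochastic, hence
nonexpansive on block vectors whatever the size of `η`; this makes the constants independent of `η`.

The first task is a steady-state fourth moment `E‖e‖⁴ = O(μ²)` for `e = wη - w_i`. The recursion for
`e` itself carries the bias `μ²η²𝓛²wη`, which is only `O(μ)` when `μη` is of order one and would
swamp a contraction of rate `1 - O(μ)`. Optimality, `∇J(wη) + η𝓛wη = 0`, gives `𝓒wη = wη + μ∇J(wη)`,
so centring at `y = wη + μ∇J(wη)` removes that bias (`center_sub_iterates_succ`) and leaves a drift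
perturbation of order `μ²` (`norm_drift_le`). Monotonicity bounds `wη` uniformly in `η`
(`norm_minimizer_le`). Since the noise is conditionally centred, `E‖y - w_i‖⁴` contracts by `1 -
μν/8` up to `O(μ³)` (`fourth_moment_step`), and returning to `wη` costs a shift of size `O(μ)`.

In `d = e - e'` both the noise and the bias cancel exactly: `d_{i+1} = 𝓒((I - μ𝓗)d_i + μr_i)`, where
`r_i` is the linearization error of the gradient, at most a constant times `‖e_i‖²`. Convexity of
the square turns this into a contraction of `E‖d‖²` by `1 - μν/2`, driven by `μE‖e‖⁴ = O(μ³)`, so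
`E‖d‖² = O(μ²)`.

Finally `|‖e‖² - ‖e'‖²| ≤ r‖e‖² + (1 + 1/r)‖d‖²`. With `E‖e‖² = O(μ)` and `E‖d‖² = O(μ²)`, the
choice `r = √μ` balances the two terms at `μ^{3/2}`. -/

/-! ### The Laplacian and the combination matrix. -/

lemma laplacian_isSymm {N : ℕ} {A : Matrix (Fin N) (Fin N) ℝ} (hA : A.IsSymm) :
    (laplacian A).IsSymm := by
  unfold laplacian
  exact (Matrix.isSymm_diagonal _).sub hA

lemma sum_laplacian_row {N : ℕ} (A : Matrix (Fin N) (Fin N) ℝ) (k : Fin N) :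
    ∑ l, laplacian A k l = 0 := by
  simp [laplacian, Matrix.diagonal_apply]

lemma bigLaplacian_apply {N M : ℕ} (A : Matrix (Fin N) (Fin N) ℝ) (v : NetVec N M) (k : Fin N) :
    bigLaplacian M A v k = ∑ l, laplacian A k l • v l := rfl

lemma inner_bigLaplacian_comm {N M : ℕ} {A : Matrix (Fin N) (Fin N) ℝ} (hA : A.IsSymm)
    (u v : NetVec N M) : inner ℝ u (bigLaplacian M A v) = inner ℝ (bigLaplacian M A u) v := by
  simp only [PiLp.inner_apply, bigLaplacian_apply, inner_sum, sum_inner, inner_smul_left,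
    inner_smul_right]
  rw [Finset.sum_comm]
  refine Finset.sum_congr rfl fun k _ => Finset.sum_congr rfl fun l _ => ?_
  rw [(laplacian_isSymm hA).apply]
  simp

lemma norm_sq_netVec {N M : ℕ} (v : NetVec N M) : ‖v‖ ^ 2 = ∑ k, ‖v k‖ ^ 2 :=
  PiLp.norm_sq_eq_of_L2 _ v

lemma norm_le_norm_netVec {N M : ℕ} (v : NetVec N M) (k : Fin N) : ‖v k‖ ≤ ‖v‖ :=
  PiLp.norm_apply_le v k

/-- A doubly stochastic matrix acts on block vectors as a nonexpansive map. -/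
lemma norm_sum_smul_sq_le {N M : ℕ} {W : Matrix (Fin N) (Fin N) ℝ} (hnn : ∀ k l, 0 ≤ W k l)
    (hrow : ∀ k, ∑ l, W k l = 1) (hcol : ∀ l, ∑ k, W k l = 1) (v : NetVec N M) :
    ∑ k, ‖∑ l, W k l • v l‖ ^ 2 ≤ ‖v‖ ^ 2 := by
  -- Jensen on each row; the column sums are what is needed when these bounds are added over `k`.
  have hk : ∀ k, ‖∑ l, W k l • v l‖ ^ 2 ≤ ∑ l, W k l * ‖v l‖ ^ 2 := by
    intro k
    have h1 : ‖∑ l, W k l • v l‖ ≤ ∑ l, W k l * ‖v l‖ := by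
      refine (norm_sum_le _ _).trans (le_of_eq ?_)
      refine Finset.sum_congr rfl fun l _ => ?_
      rw [norm_smul, Real.norm_of_nonneg (hnn k l)]
    calc ‖∑ l, W k l • v l‖ ^ 2 ≤ (∑ l, W k l * ‖v l‖) ^ 2 := by gcongr
      _ ≤ ∑ l, W k l * ‖v l‖ ^ 2 :=
        Real.pow_arith_mean_le_arith_mean_pow _ _ _ (fun l _ => hnn k l) (hrow k)
          (fun l _ => norm_nonneg _) 2
  calc ∑ k, ‖∑ l, W k l • v l‖ ^ 2 ≤ ∑ k, ∑ l, W k l * ‖v l‖ ^ 2 :=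
        Finset.sum_le_sum fun k _ => hk k
    _ = ‖v‖ ^ 2 := by
        rw [Finset.sum_comm, norm_sq_netVec]
        refine Finset.sum_congr rfl fun l _ => ?_
        rw [← Finset.sum_mul, hcol, one_mul]

lemma norm_combination_le {N M : ℕ} {A : Matrix (Fin N) (Fin N) ℝ} (hA : A.IsSymm) {c : ℝ}
    (hnn : ∀ k l, 0 ≤ (1 - c • laplacian A : Matrix (Fin N) (Fin N) ℝ) k l) (v : NetVec N M) :
    ‖(1 - c • bigLaplacian M A : Module.End ℝ (NetVec N M)) v‖ ≤ ‖v‖ := by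
  have hrow : ∀ k, ∑ l, (1 - c • laplacian A : Matrix (Fin N) (Fin N) ℝ) k l = 1 := by
    intro k
    simp [Matrix.one_apply, ← Finset.mul_sum, sum_laplacian_row]
  have hsymm : (1 - c • laplacian A : Matrix (Fin N) (Fin N) ℝ).IsSymm :=
    Matrix.isSymm_one.sub ((laplacian_isSymm hA).smul c)
  have hcol : ∀ l, ∑ k, (1 - c • laplacian A : Matrix (Fin N) (Fin N) ℝ) k l = 1 := by
    intro l
    rw [← hrow l]
    exact Finset.sum_congr rfl fun k _ => hsymm.apply _ _
  have hk : ∀ k, (1 - c • bigLaplacian M A : Module.End ℝ (NetVec N M)) v k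
      = ∑ l, (1 - c • laplacian A : Matrix (Fin N) (Fin N) ℝ) k l • v l := by
    intro k
    simp [bigLaplacian_apply, sub_smul, Matrix.one_apply, Finset.smul_sum, smul_smul]
  refine le_of_sq_le_sq ?_ (norm_nonneg _)
  simp only [norm_sq_netVec ((1 - c • bigLaplacian M A : Module.End ℝ (NetVec N M)) v), hk]
  exact norm_sum_smul_sq_le hnn hrow hcol v

/-- Cauchy–Schwarz and nonexpansiveness give `⟨v, (I - μη𝓛)v⟩ ≤ ‖v‖²`; cancelling `‖v‖²` and
dividing by `μ` leaves the sign of the regularization term. -/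
lemma eta_inner_bigLaplacian_nonneg {N M : ℕ} {A : Matrix (Fin N) (Fin N) ℝ} (hA : A.IsSymm)
    {μ η : ℝ} (hμ : 0 < μ)
    (hnn : ∀ k l, 0 ≤ (1 - (μ * η) • laplacian A : Matrix (Fin N) (Fin N) ℝ) k l)
    (v : NetVec N M) : 0 ≤ η * inner ℝ v (bigLaplacian M A v) := by
  have h1 : inner ℝ v ((1 - (μ * η) • bigLaplacian M A : Module.End ℝ (NetVec N M)) v)
      ≤ ‖v‖ ^ 2 := by
    refine (real_inner_le_norm _ _).trans ?_
    rw [sq]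
    gcongr
    exact norm_combination_le hA hnn v
  simp only [LinearMap.sub_apply, Module.End.one_apply, LinearMap.smul_apply, inner_sub_right,
    inner_smul_right, real_inner_self_eq_norm_sq] at h1
  have h2 : 0 ≤ μ * (η * inner ℝ v (bigLaplacian M A v)) := by linarith
  exact nonneg_of_mul_nonneg_right h2 hμ

/-- The stacked gradients `col {∇J_k(w_k)}`. -/
noncomputable def gradVec {N M : ℕ} (J : Fin N → Param M → ℝ) (w : NetVec N M) : NetVec N M :=
  WithLp.toLp 2 (fun k => gradient (J k) (w k))

lemma gradVec_apply {N M : ℕ} (J : Fin N → Param M → ℝ) (w : NetVec N M) (k : Fin N) :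
    gradVec J w k = gradient (J k) (w k) := rfl

/-! ### Calculus of one strongly convex cost. -/

section SingleCost

variable {M : ℕ} {f : Param M → ℝ}

lemma inner_hessian_comm (hf : Differentiable ℝ f) (hg : Differentiable ℝ (gradient f))
    (x u v : Param M) : inner ℝ (hessian f x u) v = inner ℝ (hessian f x v) u := by
  let T : Param M →L[ℝ] StrongDual ℝ (Param M) := innerSL ℝ
  have h1 : ∀ y, HasFDerivAt f (T (gradient f y)) y := fun y =>
    (hf y).hasGradientAt.hasFDerivAt
  have h2 : HasFDerivAt (fun y => T (gradient f y)) (T.comp (hessian f x)) x :=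
    T.hasFDerivAt.comp x (hg x).hasFDerivAt
  exact second_derivative_symmetric h1 h2 u v

/-- The Hessian is symmetric because it is a second derivative, and for a symmetric nonnegative
operator a bound on the quadratic form is a bound on the operator norm. -/
lemma norm_hessian_le {ν Λ : ℝ} (hν : 0 ≤ ν) (hΛ : 0 ≤ Λ)
    (hf : Differentiable ℝ f) (hg : Differentiable ℝ (gradient f))
    (hlow : ∀ w v, ν * ‖v‖ ^ 2 ≤ inner ℝ (hessian f w v) v)
    (hup : ∀ w v, inner ℝ (hessian f w v) v ≤ Λ * ‖v‖ ^ 2) (x : Param M) :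
    ‖hessian f x‖ ≤ Λ := by
  refine ContinuousLinearMap.opNorm_le_bound _ hΛ fun v => ?_
  set H := hessian f x
  have hpos : ∀ y, 0 ≤ inner ℝ (H y) y := fun y => (by positivity : (0 : ℝ) ≤ ν * ‖y‖ ^ 2).trans
    (hlow x y)
  rcases eq_or_lt_of_le hΛ with h0 | h0
  -- When `Λ = 0` the form vanishes identically, and polarizing along `v + Hv` gives `‖Hv‖² = 0`.
  · have hz : ∀ y, inner ℝ (H y) y = 0 := fun y => le_antisymm
      ((hup x y).trans (by rw [← h0]; simp)) (hpos y)
    have h := hz (v + H v)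
    simp only [map_add, inner_add_left, inner_add_right, hz] at h
    rw [inner_hessian_comm hf hg x (H v) v, real_inner_self_eq_norm_sq] at h
    have : ‖H v‖ ^ 2 = 0 := by linarith
    have : ‖H v‖ = 0 := by simpa using this
    rw [this, ← h0, zero_mul]
  -- Nonnegativity at `v - Λ⁻¹Hv`, combined with the upper bounds at `v` and at `Hv`, yields `‖Hv‖²
  -- ≤ Λ²‖v‖²`.
  · have h := hpos (v - (Λ⁻¹) • H v)
    have h3 := hup x (H v)
    simp only [map_sub, map_smul, inner_sub_left, inner_sub_right, inner_smul_left,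
      inner_smul_right] at h
    rw [inner_hessian_comm hf hg x (H v) v, real_inner_self_eq_norm_sq] at h
    simp only [RCLike.conj_to_real] at h
    have h4 := hup x v
    have h5 : Λ⁻¹ * (Λ⁻¹ * inner ℝ (H (H v)) (H v)) ≤ Λ⁻¹ * (Λ⁻¹ * (Λ * ‖H v‖ ^ 2)) := by gcongr
    rw [inv_mul_cancel_left₀ h0.ne'] at h5
    have h6 : Λ⁻¹ * ‖H v‖ ^ 2 ≤ Λ * ‖v‖ ^ 2 := by linarith
    have h7 : ‖H v‖ ^ 2 ≤ (Λ * ‖v‖) ^ 2 := by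
      have := mul_le_mul_of_nonneg_left h6 h0.le
      rw [mul_inv_cancel_left₀ h0.ne'] at this
      nlinarith
    exact le_of_sq_le_sq h7 (by positivity)

lemma norm_gradient_sub_le {Λ : ℝ} (hg : Differentiable ℝ (gradient f))
    (hH : ∀ x, ‖hessian f x‖ ≤ Λ) (x y : Param M) :
    ‖gradient f x - gradient f y‖ ≤ Λ * ‖x - y‖ :=
  convex_univ.norm_image_sub_le_of_norm_fderiv_le (fun z _ => hg z) (fun z _ => hH z)
    (Set.mem_univ y) (Set.mem_univ x)

/-- Mean value inequality for `t ↦ ⟨∇f(y + t(x - y)), x - y⟩` on `[0, 1]`: its derivative is the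
Hessian form at `x - y`. -/
lemma le_inner_gradient_sub {ν : ℝ} (hg : Differentiable ℝ (gradient f))
    (hlow : ∀ w v, ν * ‖v‖ ^ 2 ≤ inner ℝ (hessian f w v) v) (x y : Param M) :
    ν * ‖x - y‖ ^ 2 ≤ inner ℝ (gradient f x - gradient f y) (x - y) := by
  have hd : ∀ t : ℝ, HasDerivAt (fun t : ℝ => inner ℝ (gradient f (y + t • (x - y))) (x - y))
      (inner ℝ (hessian f (y + t • (x - y)) (x - y)) (x - y)) t := by
    intro t
    have h1 : HasDerivAt (fun t : ℝ => y + t • (x - y)) (x - y) t := by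
      simpa using ((hasDerivAt_id t).smul_const (x - y)).const_add y
    have h2 := (hg (y + t • (x - y))).hasFDerivAt.comp_hasDerivAt t h1
    have h3 := h2.inner ℝ (hasDerivAt_const t (x - y))
    rw [inner_zero_right, zero_add] at h3
    exact h3
  have h := Convex.mul_sub_le_image_sub_of_le_deriv (convex_univ (𝕜 := ℝ) (E := ℝ))
    (f := fun t : ℝ => inner ℝ (gradient f (y + t • (x - y))) (x - y))
    (fun t _ => (hd t).continuousAt.continuousWithinAt)
    (fun t _ => (hd t).differentiableAt.differentiableWithinAt)
    (C := ν * ‖x - y‖ ^ 2) (fun t _ => by rw [(hd t).deriv]; exact hlow _ _)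
    0 (Set.mem_univ _) 1 (Set.mem_univ _) zero_le_one
  simpa [inner_sub_left] using h

/-- The linearization error of the gradient is globally quadratic. -/
lemma norm_gradient_linearization_le {Λ κ ε : ℝ} (hε : 0 < ε) (hκ : 0 ≤ κ) (hΛ : 0 ≤ Λ)
    (hg : Differentiable ℝ (gradient f)) (hH : ∀ x, ‖hessian f x‖ ≤ Λ) (x : Param M)
    (hs : ∀ Δ : Param M, ‖Δ‖ ≤ ε → ‖hessian f (x + Δ) - hessian f x‖ ≤ κ * ‖Δ‖) (y : Param M) :
    ‖gradient f y - gradient f x - hessian f x (y - x)‖ ≤ (κ + 2 * Λ / ε) * ‖y - x‖ ^ 2 := by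
  rcases le_or_gt ‖y - x‖ ε with h | h
  -- Near `x` the Hessian varies by at most `κ‖y - x‖` on the ball through `y`, so the gradient
  -- deviates from its linearization by at most `κ‖y - x‖²`.
  · have h1 := (convex_closedBall x ‖y - x‖).norm_image_sub_le_of_norm_fderiv_le' (𝕜 := ℝ)
      (f := gradient f) (φ := hessian f x) (C := κ * ‖y - x‖)
      (fun z _ => hg z) (fun z hz => by
        have hz' : ‖z - x‖ ≤ ‖y - x‖ := by simpa [dist_eq_norm] using hz
        have h2 := hs (z - x) (hz'.trans h)
        rw [add_sub_cancel] at h2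
        exact h2.trans (by gcongr))
      (x := x) (y := y) (by simp) (by simp [dist_eq_norm])
    refine h1.trans ?_
    have : 0 ≤ 2 * Λ / ε * ‖y - x‖ ^ 2 := by positivity
    nlinarith
  -- Beyond distance `ε` the Lipschitz bound `2Λ‖y - x‖` is already quadratic, since `‖y - x‖ ≤ ‖y -
  -- x‖²/ε`; no smoothness of the Hessian is needed there.
  · have h1 := norm_gradient_sub_le hg hH y x
    have h2 : ‖hessian f x (y - x)‖ ≤ Λ * ‖y - x‖ :=
      (ContinuousLinearMap.le_opNorm _ _).trans (by gcongr; exact hH x)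
    have h3 : ‖y - x‖ ≤ ‖y - x‖ ^ 2 / ε := by
      rw [le_div_iff₀ hε, sq]; gcongr
    have h4 : 2 * Λ * ‖y - x‖ ≤ 2 * Λ * (‖y - x‖ ^ 2 / ε) := by gcongr
    have h5 : 0 ≤ κ * ‖y - x‖ ^ 2 := by positivity
    calc _ ≤ ‖gradient f y - gradient f x‖ + ‖hessian f x (y - x)‖ := norm_sub_le _ _
      _ ≤ 2 * Λ * (‖y - x‖ ^ 2 / ε) := by linarith
      _ = 2 * Λ / ε * ‖y - x‖ ^ 2 := by ring
      _ ≤ _ := by linarith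

end SingleCost

/-! ### Strong monotonicity and Lipschitz bounds for the stacked gradient. -/

lemma norm_netVec_le_of_block_le {N M : ℕ} {u v : NetVec N M} {c : ℝ} (hc : 0 ≤ c)
    (h : ∀ k, ‖u k‖ ≤ c * ‖v k‖) : ‖u‖ ≤ c * ‖v‖ := by
  refine le_of_sq_le_sq ?_ (by positivity)
  rw [mul_pow, norm_sq_netVec, norm_sq_netVec, Finset.mul_sum]
  refine Finset.sum_le_sum fun k _ => ?_
  rw [← mul_pow]
  gcongr
  exact h k

/-- A gradient step on a strongly monotone Lipschitz map is a contraction. -/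
lemma norm_sub_smul_le {E : Type*} [NormedAddCommGroup E] [InnerProductSpace ℝ E] {v d : E}
    {μ ν Λ : ℝ} (hμ : 0 ≤ μ) (hmono : ν * ‖v‖ ^ 2 ≤ inner ℝ d v)
    (hlip : ‖d‖ ≤ Λ * ‖v‖) (hμν : μ * ν ≤ 1) (hμΛ : μ * Λ ^ 2 ≤ ν) :
    ‖v - μ • d‖ ≤ (1 - μ * ν / 2) * ‖v‖ := by
  refine le_of_sq_le_sq ?_ (mul_nonneg (by linarith) (norm_nonneg _))
  rw [norm_sub_sq_real, inner_smul_right, norm_smul, real_inner_comm, Real.norm_of_nonneg hμ,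
    mul_pow, mul_pow]
  -- The squared factor is at most `1 - 2μν + μ²Λ² ≤ 1 - μν ≤ (1 - μν/2)²`.
  have h1 : ‖d‖ ^ 2 ≤ (Λ * ‖v‖) ^ 2 := by gcongr
  have h2 : μ * (μ * ‖d‖ ^ 2) ≤ μ * (μ * (Λ * ‖v‖) ^ 2) := by gcongr
  have h3 : μ * (μ * Λ ^ 2 * ‖v‖ ^ 2) ≤ μ * (ν * ‖v‖ ^ 2) := by gcongr
  have h4 : μ * (ν * ‖v‖ ^ 2) ≤ μ * inner ℝ d v := by gcongr
  nlinarith [sq_nonneg (μ * ν * ‖v‖)]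

/-- Uniform bounds `ν`, `Λ` on the Hessians of the individual costs. -/
structure UniformCosts {N M : ℕ} (J : Fin N → Param M → ℝ) (ν Λ : ℝ) : Prop where
  pos_lower : 0 < ν
  pos_upper : 0 < Λ
  differentiable : ∀ k, Differentiable ℝ (J k)
  differentiable_gradient : ∀ k, Differentiable ℝ (gradient (J k))
  lower : ∀ k w v, ν * ‖v‖ ^ 2 ≤ inner ℝ (hessian (J k) w v) v
  norm_le : ∀ k w, ‖hessian (J k) w‖ ≤ Λ

lemma StronglyConvexCosts.exists_uniformCosts {N M : ℕ} {J : Fin N → Param M → ℝ}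
    {lmin lmax : Fin N → ℝ} (hJ : StronglyConvexCosts J lmin lmax) :
    ∃ ν Λ, UniformCosts J ν Λ := by
  obtain ⟨ν, hν, hν'⟩ : ∃ ν, 0 < ν ∧ ∀ k, ν ≤ lmin k := by
    -- A network without agents has no smallest `lmin k`, so any positive value will do.
    rcases isEmpty_or_nonempty (Fin N) with h | h
    · exact ⟨1, one_pos, fun k => h.elim k⟩
    · obtain ⟨k₀, hk₀⟩ := Finite.exists_min lmin
      exact ⟨lmin k₀, hJ.lmin_pos k₀, hk₀⟩
  have hΛ : ∀ k, lmax k ≤ 1 + ∑ l, |lmax l| := fun k => by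
    have := Finset.single_le_sum (f := fun l => |lmax l|) (fun l _ => abs_nonneg _)
      (Finset.mem_univ k)
    have := le_abs_self (lmax k)
    linarith
  have hΛ0 : 0 < 1 + ∑ l, |lmax l| := by
    have := Finset.sum_nonneg (s := Finset.univ) fun (l : Fin N) _ => abs_nonneg (lmax l)
    linarith
  have hlow : ∀ k w v, ν * ‖v‖ ^ 2 ≤ inner ℝ (hessian (J k) w v) v := fun k w v =>
    (by gcongr; exact hν' k : _ ≤ lmin k * ‖v‖ ^ 2).trans (hJ.lower k w v)
  exact ⟨ν, 1 + ∑ l, |lmax l|, hν, hΛ0, hJ.differentiable, hJ.differentiable_gradient, hlow,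
    fun k => norm_hessian_le hν.le hΛ0.le (hJ.differentiable k) (hJ.differentiable_gradient k)
      (hlow k) fun w v => (hJ.upper k w v).trans (by gcongr; exact hΛ k)⟩

section Network

variable {N M : ℕ} {J : Fin N → Param M → ℝ} {ν Λ : ℝ}

lemma UniformCosts.norm_gradVec_sub_le (hJ : UniformCosts J ν Λ) (x y : NetVec N M) :
    ‖gradVec J x - gradVec J y‖ ≤ Λ * ‖x - y‖ :=
  norm_netVec_le_of_block_le hJ.pos_upper.le fun k =>
    norm_gradient_sub_le (hJ.differentiable_gradient k) (hJ.norm_le k) (x k) (y k)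

lemma UniformCosts.le_inner_gradVec_sub (hJ : UniformCosts J ν Λ) (x y : NetVec N M) :
    ν * ‖x - y‖ ^ 2 ≤ inner ℝ (gradVec J x - gradVec J y) (x - y) := by
  rw [norm_sq_netVec, PiLp.inner_apply, Finset.mul_sum]
  exact Finset.sum_le_sum fun k _ =>
    le_inner_gradient_sub (hJ.differentiable_gradient k) (hJ.lower k) (x k) (y k)

lemma UniformCosts.continuous_gradVec (hJ : UniformCosts J ν Λ) : Continuous (gradVec J) :=
  (LipschitzWith.of_dist_le_mul (K := ⟨Λ, hJ.pos_upper.le⟩) fun x y => by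
    rw [dist_eq_norm, dist_eq_norm]; exact hJ.norm_gradVec_sub_le x y).continuous

lemma UniformCosts.norm_bigHessian_le (hJ : UniformCosts J ν Λ) (w v : NetVec N M) :
    ‖bigHessian J w v‖ ≤ Λ * ‖v‖ :=
  norm_netVec_le_of_block_le hJ.pos_upper.le fun k =>
    (ContinuousLinearMap.le_opNorm _ _).trans (by gcongr; exact hJ.norm_le k (w k))

lemma UniformCosts.le_inner_bigHessian (hJ : UniformCosts J ν Λ) (w v : NetVec N M) :
    ν * ‖v‖ ^ 2 ≤ inner ℝ (bigHessian J w v) v := by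
  rw [norm_sq_netVec, PiLp.inner_apply, Finset.mul_sum]
  exact Finset.sum_le_sum fun k _ => hJ.lower k (w k) (v k)

lemma UniformCosts.norm_gradVec_linearization_le (hJ : UniformCosts J ν Λ) {κ ε : ℝ}
    (hκ : 0 ≤ κ) (hε : 0 < ε) {x : NetVec N M} (hs : HessianSmoothAt J x κ ε) (y : NetVec N M) :
    ‖gradVec J y - gradVec J x - bigHessian J x (y - x)‖ ≤ (κ + 2 * Λ / ε) * ‖y - x‖ ^ 2 := by
  have hΛ := hJ.pos_upper
  rw [sq, ← mul_assoc]
  refine norm_netVec_le_of_block_le (by positivity) fun k => ?_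
  have h := norm_gradient_linearization_le hε hκ hΛ.le (hJ.differentiable_gradient k)
    (hJ.norm_le k) (x k) (hs k) (y k)
  refine h.trans ?_
  rw [sq, ← mul_assoc]
  have h1 := norm_le_norm_netVec (y - x) k
  have h2 : ‖(y - x) k‖ = ‖y k - x k‖ := rfl
  rw [h2] at h1 ⊢
  gcongr

/-! ### The regularized minimizer. -/

lemma hasDerivAt_add_smul {E : Type*} [NormedAddCommGroup E] [NormedSpace ℝ E] (x v : E) :
    HasDerivAt (fun t : ℝ => x + t • v) v 0 := by
  simpa using ((hasDerivAt_id (0 : ℝ)).smul_const v).const_add x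

lemma hasDerivAt_comp_add_smul {f : Param M → ℝ} (hf : Differentiable ℝ f) (x v : Param M) :
    HasDerivAt (fun t : ℝ => f (x + t • v)) (inner ℝ (gradient f x) v) 0 := by
  have hg : HasFDerivAt f (InnerProductSpace.toDual ℝ (Param M) (gradient f x))
      (x + (0 : ℝ) • v) := by
    rw [zero_smul, add_zero]
    exact (hf x).hasGradientAt.hasFDerivAt
  exact hg.comp_hasDerivAt (0 : ℝ) (hasDerivAt_add_smul x v)

lemma hasDerivAt_inner_self_add_smul {E : Type*} [NormedAddCommGroup E] [InnerProductSpace ℝ E]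
    (L : Module.End ℝ E) (x v : E) :
    HasDerivAt (fun t : ℝ => inner ℝ (x + t • v) (L (x + t • v)))
      (inner ℝ x (L v) + inner ℝ v (L x)) 0 := by
  have h1 : (fun t : ℝ => inner ℝ (x + t • v) (L (x + t • v))) = fun t : ℝ =>
      inner ℝ x (L x) + t * (inner ℝ x (L v) + inner ℝ v (L x)) + t ^ 2 * inner ℝ v (L v) := by
    funext t
    simp only [map_add, map_smul, inner_add_left, inner_add_right, inner_smul_left,
      inner_smul_right, RCLike.conj_to_real]
    ring
  rw [h1]
  have h2 := (((hasDerivAt_id (0 : ℝ)).mul_const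
    (inner ℝ x (L v) + inner ℝ v (L x))).const_add (inner ℝ x (L x))).add
    (((hasDerivAt_id (0 : ℝ)).pow 2).mul_const (inner ℝ v (L v)))
  exact h2.congr_deriv (by simp)

/-- First order optimality of the regularized solution. -/
lemma gradVec_add_smul_bigLaplacian_eq_zero (hJ : UniformCosts J ν Λ)
    {A : Matrix (Fin N) (Fin N) ℝ} (hA : A.IsSymm) {η : ℝ} {wη : NetVec N M}
    (hmin : IsMinOn (globalCost A J η) Set.univ wη) :
    gradVec J wη + η • bigLaplacian M A wη = 0 := by
  refine ext_inner_right ℝ fun v => ?_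
  have h1 : HasDerivAt (fun t : ℝ => ∑ k, J k (wη k + t • v k))
      (∑ k, inner ℝ (gradVec J wη k) (v k)) 0 :=
    HasDerivAt.fun_sum fun k _ => hasDerivAt_comp_add_smul (hJ.differentiable k) (wη k) (v k)
  have hd := h1.add ((hasDerivAt_inner_self_add_smul (bigLaplacian M A) wη v).const_mul (η / 2))
  have hloc : IsLocalMin (fun t : ℝ => globalCost A J η (wη + t • v)) 0 :=
    Eventually.of_forall fun t => by
      have h := isMinOn_iff.1 hmin (wη + t • v) (Set.mem_univ _)
      show globalCost A J η (wη + (0 : ℝ) • v) ≤ globalCost A J η (wη + t • v)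
      rwa [zero_smul, add_zero]
  have h0 := IsLocalMin.hasDerivAt_eq_zero (f := fun t : ℝ => globalCost A J η (wη + t • v))
    hloc hd
  rw [inner_bigLaplacian_comm hA, real_inner_comm (bigLaplacian M A wη) v] at h0
  rw [inner_zero_left, inner_add_left, inner_smul_left, PiLp.inner_apply]
  simp only [RCLike.conj_to_real]
  linarith

/-- The regularized solution is bounded uniformly in the regularization strength. -/
lemma norm_minimizer_le (hJ : UniformCosts J ν Λ) {A : Matrix (Fin N) (Fin N) ℝ}
    {η : ℝ} {wη : NetVec N M} (hpos : 0 ≤ η * inner ℝ wη (bigLaplacian M A wη))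
    (hopt : gradVec J wη + η • bigLaplacian M A wη = 0) :
    ‖wη‖ ≤ ‖gradVec J 0‖ / ν := by
  have h1 := hJ.le_inner_gradVec_sub wη 0
  rw [eq_neg_of_add_eq_zero_left hopt] at h1
  simp only [sub_zero, inner_sub_left, inner_neg_left, inner_smul_left, RCLike.conj_to_real] at h1
  rw [real_inner_comm] at h1
  -- Optimality tested against `wη` gives `ν‖wη‖² ≤ -⟨∇J(0), wη⟩`: the regularization term has the
  -- favourable sign and drops out.
  have h2 : -inner ℝ (gradVec J 0) wη ≤ ‖gradVec J 0‖ * ‖wη‖ := by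
    rw [← inner_neg_left, ← norm_neg (gradVec J 0)]
    exact real_inner_le_norm _ _
  rw [le_div_iff₀ hJ.pos_lower]
  rcases (norm_nonneg wη).eq_or_lt with h0 | h0
  · rw [← h0]; simp
  · refine le_of_mul_le_mul_right ?_ h0
    linarith

/-! ### Recursions for the iterates and for the approximation error. -/

variable {Ω : Type*} {A : Matrix (Fin N) (Fin N) ℝ} {μ η : ℝ}
  {g : Fin N → ℕ → Ω → Param M → Param M} {w₀ : Ω → NetVec N M}

lemma iterates_succ_eq (i : ℕ) (ω : Ω) :
    iterates A μ η g w₀ (i + 1) ω =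
      (1 - (μ * η) • bigLaplacian M A : Module.End ℝ (NetVec N M))
        (iterates A μ η g w₀ i ω - μ • gradVec J (iterates A μ η g w₀ i ω)
          + μ • noiseVec J g (i + 1) ω (iterates A μ η g w₀ i ω)) := by
  set w := iterates A μ η g w₀ i ω with hw
  have h : iterates A μ η g w₀ (i + 1) ω = diffusionStep A μ η (fun k => g k (i + 1) ω) w := rfl
  have hψ : w - μ • gradVec J w + μ • noiseVec J g (i + 1) ω w
      = WithLp.toLp 2 (fun k => w k - μ • g k (i + 1) ω (w k)) := by
    ext k : 1
    simp only [PiLp.add_apply, PiLp.sub_apply, PiLp.smul_apply, gradVec_apply, noiseVec,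
      gradientNoise, smul_sub]
    abel
  rw [h, hψ]
  ext k : 1
  simp only [diffusionStep, LinearMap.sub_apply, Module.End.one_apply, LinearMap.smul_apply,
    PiLp.sub_apply, PiLp.smul_apply, bigLaplacian_apply]
  congr 2
  simp [laplacian, sub_smul, smul_sub, Finset.sum_sub_distrib, Matrix.diagonal_apply,
    Finset.sum_smul]
  abel

/-- Centred at `wη + μ ∇J(wη)`, the recursion of the iterates has no bias term. -/
lemma center_sub_iterates_succ {wη : NetVec N M}
    (hopt : gradVec J wη + η • bigLaplacian M A wη = 0) (i : ℕ) (ω : Ω) :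
    wη + μ • gradVec J wη - iterates A μ η g w₀ (i + 1) ω =
      (1 - (μ * η) • bigLaplacian M A : Module.End ℝ (NetVec N M))
        ((wη - iterates A μ η g w₀ i ω + μ • gradVec J (iterates A μ η g w₀ i ω))
          - μ • noiseVec J g (i + 1) ω (iterates A μ η g w₀ i ω)) := by
  rw [iterates_succ_eq (J := J)]
  -- By optimality the new centre is exactly the image of `wη` under the combination operator, which
  -- therefore factors out of the whole recursion.
  have h : wη + μ • gradVec J wη
      = (1 - (μ * η) • bigLaplacian M A : Module.End ℝ (NetVec N M)) wη := by
    rw [eq_neg_of_add_eq_zero_left hopt]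
    simp [smul_smul, sub_eq_add_neg]
  rw [h, ← map_sub]
  congr 1
  abel

/-- Up to `μ(∇J(y) - ∇J(wη))`, the drift is a contracting gradient step from `y - w`. Since `y - wη
= μ∇J(wη)`, that correction has size `μ²`. -/
lemma norm_drift_le (hJ : UniformCosts J ν Λ) (hμ : 0 ≤ μ) (hμν : μ * ν ≤ 1)
    (hμΛ : μ * Λ ^ 2 ≤ ν) (wη w : NetVec N M) :
    ‖wη - w + μ • gradVec J w‖ ≤ (1 - μ * ν / 2) * ‖wη + μ • gradVec J wη - w‖
      + μ ^ 2 * (Λ * ‖gradVec J wη‖) := by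
  set y := wη + μ • gradVec J wη with hy
  have h1 := norm_sub_smul_le hμ (hJ.le_inner_gradVec_sub y w) (hJ.norm_gradVec_sub_le y w) hμν hμΛ
  have h2 : ‖μ • (gradVec J y - gradVec J wη)‖ ≤ μ ^ 2 * (Λ * ‖gradVec J wη‖) := by
    rw [norm_smul, Real.norm_of_nonneg hμ]
    have := hJ.norm_gradVec_sub_le y wη
    rw [hy, add_sub_cancel_left, norm_smul, Real.norm_of_nonneg hμ, ← hy] at this
    calc _ ≤ μ * (Λ * (μ * ‖gradVec J wη‖)) := by gcongr
      _ = _ := by ring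
  have h3 : wη - w + μ • gradVec J w = (y - w - μ • (gradVec J y - gradVec J w))
      + μ • (gradVec J y - gradVec J wη) := by
    rw [hy]; module
  rw [h3]
  exact (norm_add_le _ _).trans (add_le_add h1 h2)

/-- The approximation error of the long-term model contracts up to a quadratic term. -/
lemma norm_error_sub_longTermStep_le (hJ : UniformCosts J ν Λ) (hA : A.IsSymm) (hμ : 0 ≤ μ)
    (hμν : μ * ν ≤ 1) (hμΛ : μ * Λ ^ 2 ≤ ν)
    (hnn : ∀ k l, 0 ≤ (1 - (μ * η) • laplacian A : Matrix (Fin N) (Fin N) ℝ) k l)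
    {wη : NetVec N M} (hopt : gradVec J wη + η • bigLaplacian M A wη = 0) {κ ε : ℝ}
    (hκ : 0 ≤ κ) (hε : 0 < ε) (hs : HessianSmoothAt J wη κ ε) (i : ℕ) (ω : Ω) (e' : NetVec N M) :
    ‖wη - iterates A μ η g w₀ (i + 1) ω - longTermStep A J μ η wη
        (noiseVec J g (i + 1) ω (iterates A μ η g w₀ i ω)) e'‖ ≤
      (1 - μ * ν / 2) * ‖wη - iterates A μ η g w₀ i ω - e'‖
        + μ * ((κ + 2 * Λ / ε) * ‖wη - iterates A μ η g w₀ i ω‖ ^ 2) := by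
  rw [iterates_succ_eq (J := J)]
  set w := iterates A μ η g w₀ i ω
  set s := noiseVec J g (i + 1) ω w
  set d := wη - w - e'
  -- The noise enters both recursions through the same operator and cancels. After optimality
  -- replaces `∇J(wη)` by `-η𝓛wη`, the bias `μ²η²𝓛²wη` cancels too.
  have heq : wη - (1 - (μ * η) • bigLaplacian M A : Module.End ℝ (NetVec N M))
        (w - μ • gradVec J w + μ • s) - longTermStep A J μ η wη s e'
      = (1 - (μ * η) • bigLaplacian M A : Module.End ℝ (NetVec N M))
        ((d - μ • bigHessian J wη d)
          + μ • (gradVec J w - gradVec J wη - bigHessian J wη (w - wη))) := by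
    rw [eq_neg_of_add_eq_zero_left hopt]
    simp only [d, longTermStep, bigB, pow_two, Module.End.mul_apply, LinearMap.sub_apply,
      Module.End.one_apply, LinearMap.smul_apply, map_add, map_sub, map_smul, map_neg]
    module
  rw [heq]
  refine (norm_combination_le hA hnn _).trans ((norm_add_le _ _).trans (add_le_add ?_ ?_))
  · exact norm_sub_smul_le hμ (hJ.le_inner_bigHessian wη d) (hJ.norm_bigHessian_le wη d) hμν hμΛ
  · rw [norm_smul, Real.norm_of_nonneg hμ, norm_sub_rev wη w]
    gcongr
    exact hJ.norm_gradVec_linearization_le hκ hε hs w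

end Network

/-! ### Moments, orthogonality and one noisy step. -/

section Moments

variable {Ω : Type*} {m0 : MeasurableSpace Ω} {P : Measure Ω}
  {E : Type*} [NormedAddCommGroup E]

lemma memLp_of_lintegral_enorm_pow {f : Ω → E} (hf : AEStronglyMeasurable f P) {p : ℕ}
    (hp : p ≠ 0) (h : ∫⁻ ω, ‖f ω‖ₑ ^ p ∂P < ⊤) : MemLp f p P := by
  refine ⟨hf, ?_⟩
  rw [eLpNorm_lt_top_iff_lintegral_rpow_enorm_lt_top (by exact_mod_cast hp) (by simp)]
  simpa using h

lemma lintegral_enorm_pow_eq {f : Ω → E} {p : ℕ} (hp : p ≠ 0) (hf : MemLp f p P) :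
    ∫⁻ ω, ‖f ω‖ₑ ^ p ∂P = ENNReal.ofReal (∫ ω, ‖f ω‖ ^ p ∂P) := by
  rw [ofReal_integral_eq_lintegral_ofReal (hf.integrable_norm_pow hp)
    (ae_of_all _ fun ω => by positivity)]
  refine lintegral_congr fun ω => ?_
  rw [ENNReal.ofReal_pow (norm_nonneg _), ofReal_norm]

/-- A random vector known from the past is orthogonal to noise with zero conditional mean. -/
lemma integral_inner_eq_zero_of_condExp_eq_zero [IsProbabilityMeasure P]
    [InnerProductSpace ℝ E] [CompleteSpace E] {m : MeasurableSpace Ω} (hm : m ≤ m0)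
    {x s : Ω → E} (hx : StronglyMeasurable[m] x) (hs : Integrable s P)
    (hxs : Integrable (fun ω => inner ℝ (x ω) (s ω)) P) (h0 : P[s | m] =ᵐ[P] 0) :
    ∫ ω, inner ℝ (x ω) (s ω) ∂P = 0 := by
  have h := condExp_bilin_of_stronglyMeasurable_left (innerSL ℝ : E →L[ℝ] E →L[ℝ] ℝ) hx hxs hs
  rw [← integral_condExp hm]
  have h' : P[fun ω => inner ℝ (x ω) (s ω) | m] =ᵐ[P] fun _ => (0 : ℝ) := by
    filter_upwards [h, h0] with ω h1 h2
    refine h1.trans ?_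
    rw [h2]
    simp
  rw [integral_congr_ae h']
  simp

end Moments

/-- Expand the square of `‖t - μs‖²`. The term linear in `s` is kept intact because it will have
zero mean; the other mixed terms amount to at most `8μ²‖t‖²‖s‖²`, which Young's inequality splits
with the free weight `δ`. -/
lemma norm_sub_smul_pow_four_le {E : Type*} [NormedAddCommGroup E] [InnerProductSpace ℝ E]
    {μ δ : ℝ} (hμ : 0 ≤ μ) (hδ : 0 < δ) (t s : E) :
    ‖t - μ • s‖ ^ 4 ≤ (1 + 4 * μ * δ) * ‖t‖ ^ 4 + (4 * μ ^ 3 / δ + 3 * μ ^ 4) * ‖s‖ ^ 4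
      - 4 * μ * inner ℝ (‖t‖ ^ 2 • t) s := by
  have h1 : ‖t - μ • s‖ ^ 4 = (‖t‖ ^ 2 - 2 * μ * inner ℝ t s + μ ^ 2 * ‖s‖ ^ 2) ^ 2 := by
    rw [show ‖t - μ • s‖ ^ 4 = (‖t - μ • s‖ ^ 2) ^ 2 by ring, norm_sub_sq_real, inner_smul_right,
      norm_smul, Real.norm_of_nonneg hμ]
    ring
  rw [h1, real_inner_smul_left]
  have hcs := abs_le.1 (abs_real_inner_le_norm t s)
  have hsq : inner ℝ t s ^ 2 ≤ (‖t‖ * ‖s‖) ^ 2 := sq_le_sq' hcs.1 hcs.2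
  set a := ‖t‖ with ha
  set b := ‖s‖ with hb
  set p := inner ℝ t s
  have ha0 : 0 ≤ a := norm_nonneg _
  have hb0 : 0 ≤ b := norm_nonneg _
  have h2 : -(4 * μ ^ 3 * p * b ^ 2) ≤ 4 * μ ^ 3 * (a * b) * b ^ 2 := by
    have : 0 ≤ 4 * μ ^ 3 * b ^ 2 := by positivity
    nlinarith [hcs.1]
  have h3 : 4 * μ ^ 3 * (a * b) * b ^ 2 ≤ 2 * μ ^ 2 * a ^ 2 * b ^ 2 + 2 * μ ^ 4 * b ^ 4 := by
    nlinarith [mul_nonneg (mul_nonneg (sq_nonneg μ) (sq_nonneg b)) (sq_nonneg (a - μ * b))]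
  have h4 : 4 * μ ^ 2 * p ^ 2 ≤ 4 * μ ^ 2 * (a * b) ^ 2 := by gcongr
  have h5 : 8 * μ ^ 2 * a ^ 2 * b ^ 2 ≤ 4 * μ * δ * a ^ 4 + 4 * μ ^ 3 / δ * b ^ 4 := by
    have h6 : 0 ≤ 4 * μ / δ * (δ * a ^ 2 - μ * b ^ 2) ^ 2 := by positivity
    have h7 : 4 * μ / δ * (δ * a ^ 2 - μ * b ^ 2) ^ 2
        = 4 * μ * δ * a ^ 4 + 4 * μ ^ 3 / δ * b ^ 4 - 8 * μ ^ 2 * a ^ 2 * b ^ 2 := by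
      field_simp
      ring
    linarith
  nlinarith

lemma memLp_apply {N M : ℕ} {Ω : Type*} {m0 : MeasurableSpace Ω} {P : Measure Ω} {p : ℝ≥0∞}
    {f : Ω → NetVec N M} (hf : MemLp f p P) (k : Fin N) :
    MemLp (fun ω => f ω k) p P :=
  hf.of_le ((PiLp.continuous_apply 2 _ k).comp_aestronglyMeasurable hf.1)
    (ae_of_all _ fun ω => norm_le_norm_netVec (f ω) k)

section Noise

variable {N M : ℕ} {Ω : Type*} {m0 : MeasurableSpace Ω} {P : Measure Ω} [IsProbabilityMeasure P]

/-- Growth of the fourth moment in one step with conditionally centred noise. -/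
lemma integral_norm_sub_smul_pow_four_le {m : MeasurableSpace Ω} (hm : m ≤ m0)
    {t s : Ω → NetVec N M} (htm : Measurable[m] t) (ht : MemLp t 4 P) (hs : MemLp s 4 P)
    (h0 : ∀ k, P[fun ω => s ω k | m] =ᵐ[P] 0) {μ δ : ℝ} (hμ : 0 ≤ μ) (hδ : 0 < δ) :
    ∫ ω, ‖t ω - μ • s ω‖ ^ 4 ∂P ≤ (1 + 4 * μ * δ) * ∫ ω, ‖t ω‖ ^ 4 ∂P
      + (4 * μ ^ 3 / δ + 3 * μ ^ 4) * ∫ ω, ‖s ω‖ ^ 4 ∂P := by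
  have it : Integrable (fun ω => ‖t ω‖ ^ 4) P :=
    MemLp.integrable_norm_pow (p := 4) ht (by norm_num)
  have is : Integrable (fun ω => ‖s ω‖ ^ 4) P :=
    MemLp.integrable_norm_pow (p := 4) hs (by norm_num)
  have its : Integrable (fun ω => ‖t ω - μ • s ω‖ ^ 4) P :=
    MemLp.integrable_norm_pow (p := 4) (ht.sub (hs.const_smul μ)) (by norm_num)
  have hxm : Measurable[m] (fun ω => ‖t ω‖ ^ 2 • t ω) := (htm.norm.pow_const 2).smul htm
  -- Finite fourth moments of `t` and `s` make the cubic-linear cross term integrable.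
  have hbound : ∀ ω, ‖t ω‖ ^ 3 * ‖s ω‖ ≤ ‖t ω‖ ^ 4 + ‖s ω‖ ^ 4 := by
    intro ω
    have ha := norm_nonneg (t ω)
    have hb := norm_nonneg (s ω)
    rcases le_total ‖t ω‖ ‖s ω‖ with h | h
    · have : ‖t ω‖ ^ 3 * ‖s ω‖ ≤ ‖s ω‖ ^ 3 * ‖s ω‖ := by gcongr
      nlinarith [pow_nonneg ha 4]
    · have : ‖t ω‖ ^ 3 * ‖s ω‖ ≤ ‖t ω‖ ^ 3 * ‖t ω‖ := by gcongr
      nlinarith [pow_nonneg hb 4]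
  have hk_meas : ∀ k, Measurable[m] (fun ω => (‖t ω‖ ^ 2 • t ω) k) := fun k =>
    (PiLp.continuous_apply 2 _ k).measurable.comp hxm
  have hk_int : ∀ k, Integrable (fun ω => inner ℝ ((‖t ω‖ ^ 2 • t ω) k) (s ω k)) P := by
    intro k
    refine (it.add is).mono' ?_ (ae_of_all _ fun ω => ?_)
    · exact (((hk_meas k).mono hm le_rfl).aestronglyMeasurable).inner (memLp_apply hs k).1
    · refine (norm_inner_le_norm _ _).trans (le_trans ?_ (hbound ω))
      have h1 := norm_le_norm_netVec (‖t ω‖ ^ 2 • t ω) k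
      rw [norm_smul, norm_pow, norm_norm] at h1
      calc _ ≤ ‖t ω‖ ^ 2 * ‖t ω‖ * ‖s ω‖ := by
            gcongr
            exact norm_le_norm_netVec (s ω) k
        _ = _ := by ring
  -- The zero-mean condition is given agent by agent, so orthogonality is applied block by block.
  have hsum : ∀ ω, inner ℝ (‖t ω‖ ^ 2 • t ω) (s ω)
      = ∑ k, inner ℝ ((‖t ω‖ ^ 2 • t ω) k) (s ω k) := fun ω => PiLp.inner_apply _ _
  have hint : Integrable (fun ω => inner ℝ (‖t ω‖ ^ 2 • t ω) (s ω)) P := by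
    simp only [hsum]
    exact integrable_finsetSum _ fun k _ => hk_int k
  have hzero : ∫ ω, inner ℝ (‖t ω‖ ^ 2 • t ω) (s ω) ∂P = 0 := by
    simp only [hsum]
    rw [integral_finsetSum _ fun k _ => hk_int k]
    exact Finset.sum_eq_zero fun k _ => integral_inner_eq_zero_of_condExp_eq_zero hm
      (hk_meas k).stronglyMeasurable ((memLp_apply hs k).integrable (by norm_num))
      (hk_int k) (h0 k)
  have hts : Integrable (fun ω => (1 + 4 * μ * δ) * ‖t ω‖ ^ 4
      + (4 * μ ^ 3 / δ + 3 * μ ^ 4) * ‖s ω‖ ^ 4) P := (it.const_mul _).add (is.const_mul _)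
  calc ∫ ω, ‖t ω - μ • s ω‖ ^ 4 ∂P
      ≤ ∫ ω, ((1 + 4 * μ * δ) * ‖t ω‖ ^ 4 + (4 * μ ^ 3 / δ + 3 * μ ^ 4) * ‖s ω‖ ^ 4
        - 4 * μ * inner ℝ (‖t ω‖ ^ 2 • t ω) (s ω)) ∂P :=
        integral_mono its (hts.sub (hint.const_mul _))
          fun ω => norm_sub_smul_pow_four_le hμ hδ (t ω) (s ω)
    _ = _ := by
        rw [integral_sub hts (hint.const_mul _), integral_add (it.const_mul _) (is.const_mul _),
          integral_const_mul, integral_const_mul, integral_const_mul, hzero]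
        ring

lemma norm_pow_four_netVec_le (v : NetVec N M) : ‖v‖ ^ 4 ≤ N * ∑ k, ‖v k‖ ^ 4 := by
  have h := sq_sum_le_card_mul_sum_sq (s := Finset.univ) (f := fun k => ‖v k‖ ^ 2)
  rw [← norm_sq_netVec, Finset.card_univ, Fintype.card_fin] at h
  simpa only [← pow_mul] using h

variable {J : Fin N → Param M → ℝ} {g : Fin N → ℕ → Ω → Param M → Param M}
  {w : ℕ → Ω → NetVec N M} {β σ β4 σ4 : Fin N → ℝ}

lemma measurable_noiseVec (hJ : ∀ k, Continuous (gradient (J k)))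
    (hg : ∀ k i, Measurable (Function.uncurry (g k i))) {x : Ω → NetVec N M} (hx : Measurable x)
    (i : ℕ) : Measurable fun ω => noiseVec J g i ω (x ω) := by
  refine (WithLp.measurable_toLp 2 _).comp (measurable_pi_iff.2 fun k => ?_)
  have hk : Measurable fun ω => x ω k := (PiLp.continuous_apply 2 _ k).measurable.comp hx
  exact ((hJ k).measurable.comp hk).sub ((hg k i).comp (measurable_id.prodMk hk))

lemma pastSigma_le (hw : ∀ i, Measurable (w i)) (i : ℕ) : pastSigma w i ≤ m0 :=
  iSup₂_le fun j _ => (hw j).comap_le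

lemma measurable_pastSigma (i : ℕ) : Measurable[pastSigma w i] (w i) :=
  (comap_measurable (w i)).mono (le_iSup₂_of_le i le_rfl le_rfl) le_rfl

/-- Fourth moment of the gradient noise at the current iterate. -/
lemma lintegral_noiseVec_le (hw : ∀ i, Measurable (w i))
    (hJ : ∀ k, Continuous (gradient (J k)))
    (hg : ∀ k i, Measurable (Function.uncurry (g k i)))
    (hn : NoiseConditions P J g w β σ β4 σ4) {i : ℕ} (h4 : MemLp (w i) 4 P) :
    ∫⁻ ω, ‖noiseVec J g (i + 1) ω (w i ω)‖ₑ ^ 4 ∂P ≤ ENNReal.ofReal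
      (N * ((∑ k, β4 k ^ 4) * ∫ ω, ‖w i ω‖ ^ 4 ∂P + ∑ k, σ4 k ^ 4)) := by
  have hm := pastSigma_le hw i
  have iw : Integrable (fun ω => ‖w i ω‖ ^ 4) P :=
    MemLp.integrable_norm_pow (p := 4) h4 (by norm_num)
  have hsm := measurable_noiseVec hJ hg (hw i) (i + 1)
  have hskm : ∀ k, Measurable fun ω => noiseVec J g (i + 1) ω (w i ω) k := fun k =>
    (PiLp.continuous_apply 2 _ k).measurable.comp hsm
  have hk : ∀ k, ∫⁻ ω, ‖noiseVec J g (i + 1) ω (w i ω) k‖ₑ ^ 4 ∂P ≤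
      ENNReal.ofReal (β4 k ^ 4 * ∫ ω, ‖w i ω‖ ^ 4 ∂P + σ4 k ^ 4) := by
    intro k
    have h1 := hn.fourth k i (fun ω => w i ω k)
      ((PiLp.continuous_apply 2 _ k).measurable.comp (measurable_pastSigma i))
    have h2 := lintegral_mono_ae h1
    -- Working in `[0, ∞]` makes the conditional bound yield finiteness of the noise moment, with no
    -- prior integrability.
    rw [lintegral_condLExp hm] at h2
    refine h2.trans ?_
    have h3 : ∫ ω, (β4 k ^ 4 * ‖w i ω‖ ^ 4 + σ4 k ^ 4) ∂P
        = β4 k ^ 4 * ∫ ω, ‖w i ω‖ ^ 4 ∂P + σ4 k ^ 4 := by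
      rw [integral_add (iw.const_mul _) (integrable_const _), integral_const_mul]
      simp
    have h4 : Integrable (fun ω => β4 k ^ 4 * ‖w i ω‖ ^ 4 + σ4 k ^ 4) P :=
      (iw.const_mul _).add (integrable_const _)
    rw [← h3, ofReal_integral_eq_lintegral_ofReal h4
      (ae_of_all _ fun ω => by show 0 ≤ β4 k ^ 4 * ‖w i ω‖ ^ 4 + σ4 k ^ 4; positivity)]
    refine lintegral_mono fun ω => ENNReal.ofReal_le_ofReal ?_
    have := norm_le_norm_netVec (w i ω) k
    gcongr
  calc ∫⁻ ω, ‖noiseVec J g (i + 1) ω (w i ω)‖ₑ ^ 4 ∂P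
      ≤ ∫⁻ ω, N * ∑ k, ‖noiseVec J g (i + 1) ω (w i ω) k‖ₑ ^ 4 ∂P := by
        refine lintegral_mono fun ω => ?_
        have h := ENNReal.ofReal_le_ofReal
          (norm_pow_four_netVec_le (noiseVec J g (i + 1) ω (w i ω)))
        rw [ENNReal.ofReal_mul (by positivity), ENNReal.ofReal_natCast,
          ENNReal.ofReal_sum_of_nonneg (fun k _ => by positivity)] at h
        simpa only [ENNReal.ofReal_pow (norm_nonneg _), ofReal_norm] using h
    _ = N * ∑ k, ∫⁻ ω, ‖noiseVec J g (i + 1) ω (w i ω) k‖ₑ ^ 4 ∂P := by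
        rw [lintegral_const_mul' _ _ (by simp), lintegral_finsetSum]
        exact fun k _ => (hskm k).enorm.pow_const 4
    _ ≤ N * ∑ k, ENNReal.ofReal (β4 k ^ 4 * ∫ ω, ‖w i ω‖ ^ 4 ∂P + σ4 k ^ 4) := by
        gcongr with k
        exact hk k
    _ = _ := by
        have hnn : ∀ k, 0 ≤ β4 k ^ 4 * ∫ ω, ‖w i ω‖ ^ 4 ∂P + σ4 k ^ 4 := fun k => by
          have : 0 ≤ ∫ ω, ‖w i ω‖ ^ 4 ∂P := integral_nonneg fun ω => by positivity
          positivity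
        rw [← ENNReal.ofReal_sum_of_nonneg (fun k _ => hnn k), ← ENNReal.ofReal_natCast,
          ← ENNReal.ofReal_mul (by positivity), Finset.sum_add_distrib, Finset.sum_mul]

lemma memLp_noiseVec (hw : ∀ i, Measurable (w i)) (hJ : ∀ k, Continuous (gradient (J k)))
    (hg : ∀ k i, Measurable (Function.uncurry (g k i)))
    (hn : NoiseConditions P J g w β σ β4 σ4) {i : ℕ} (h4 : MemLp (w i) 4 P) :
    MemLp (fun ω => noiseVec J g (i + 1) ω (w i ω)) 4 P :=
  memLp_of_lintegral_enorm_pow (p := 4)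
    (measurable_noiseVec hJ hg (hw i) (i + 1)).aestronglyMeasurable (by norm_num)
    ((lintegral_noiseVec_le hw hJ hg hn h4).trans_lt ENNReal.ofReal_lt_top)

lemma integral_noiseVec_le (hw : ∀ i, Measurable (w i)) (hJ : ∀ k, Continuous (gradient (J k)))
    (hg : ∀ k i, Measurable (Function.uncurry (g k i)))
    (hn : NoiseConditions P J g w β σ β4 σ4) {i : ℕ} (h4 : MemLp (w i) 4 P) :
    ∫ ω, ‖noiseVec J g (i + 1) ω (w i ω)‖ ^ 4 ∂P ≤
      N * ((∑ k, β4 k ^ 4) * ∫ ω, ‖w i ω‖ ^ 4 ∂P + ∑ k, σ4 k ^ 4) := by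
  have h := lintegral_noiseVec_le hw hJ hg hn h4
  rw [lintegral_enorm_pow_eq (p := 4) (by norm_num) (memLp_noiseVec hw hJ hg hn h4)] at h
  have : 0 ≤ ∫ ω, ‖w i ω‖ ^ 4 ∂P := integral_nonneg fun ω => by positivity
  exact (ENNReal.ofReal_le_ofReal_iff (by positivity)).1 h

end Noise

/-! ### Scalar recursions and convexity inequalities. -/

/-- Eventual bound for a real sequence contracting up to a constant. -/
lemma eventually_le_of_contraction {u : ℕ → ℝ} {α c : ℝ} (hα : 0 < α) (hα1 : α ≤ 1) (hc : 0 < c)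
    (h : ∀ᶠ i in atTop, u (i + 1) ≤ (1 - α) * u i + c) :
    ∀ᶠ i in atTop, u i ≤ 2 * c / α := by
  obtain ⟨n₀, hn₀⟩ := eventually_atTop.1 h
  -- `c / α` is the fixed point of the recursion, approached geometrically. The second copy of `c /
  -- α` in the final bound absorbs the transient, hence the need for `c > 0`.
  have hb : ∀ n, u (n + n₀) ≤ (1 - α) ^ n * |u n₀| + c / α := by
    intro n
    induction n with
    | zero => have := le_abs_self (u n₀); simp; linarith [div_pos hc hα]
    | succ n ih =>
      have h1 := hn₀ (n + n₀) (by omega)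
      rw [show n + 1 + n₀ = n + n₀ + 1 by omega]
      have h2 := mul_le_mul_of_nonneg_left ih (sub_nonneg.2 hα1)
      have h3 : (1 - α) * (c / α) + c = c / α := by field_simp; ring
      rw [pow_succ]
      linarith
  have ht : Tendsto (fun n => (1 - α) ^ n * |u n₀|) atTop (nhds 0) := by
    simpa using (tendsto_pow_atTop_nhds_zero_of_lt_one (sub_nonneg.2 hα1)
      (by linarith)).mul_const |u n₀|
  obtain ⟨n₁, hn₁⟩ := eventually_atTop.1 (ht.eventually_lt_const (div_pos hc hα))
  refine eventually_atTop.2 ⟨n₁ + n₀, fun i hi => ?_⟩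
  have h1 := hb (i - n₀)
  have h2 := hn₁ (i - n₀) (by omega)
  rw [Nat.sub_add_cancel (by omega)] at h1
  calc u i ≤ c / α + c / α := by linarith
    _ = 2 * c / α := by ring

/-- Convexity keeps the contraction factor `1 - α` when passing to powers, whereas expanding the
power would create cross terms to absorb. -/
lemma pow_four_le_of_le_convex_comb {t z q α : ℝ} (ht : 0 ≤ t) (hz : 0 ≤ z) (hq : 0 ≤ q)
    (hα : 0 ≤ α) (hα1 : α ≤ 1) (h : t ≤ (1 - α) * z + α * q) :
    t ^ 4 ≤ (1 - α) * z ^ 4 + α * q ^ 4 := by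
  have h1 := (convexOn_pow (𝕜 := ℝ) 4).2 hz hq (sub_nonneg.2 hα1) hα (by ring)
  simp only [smul_eq_mul] at h1
  exact (by gcongr : t ^ 4 ≤ _).trans h1

lemma sq_le_of_le_convex_comb {t z q α : ℝ} (ht : 0 ≤ t) (hz : 0 ≤ z) (hq : 0 ≤ q)
    (hα : 0 ≤ α) (hα1 : α ≤ 1) (h : t ≤ (1 - α) * z + α * q) :
    t ^ 2 ≤ (1 - α) * z ^ 2 + α * q ^ 2 := by
  have h1 := (convexOn_pow (𝕜 := ℝ) 2).2 hz hq (sub_nonneg.2 hα1) hα (by ring)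
  simp only [smul_eq_mul] at h1
  exact (by gcongr : t ^ 2 ≤ _).trans h1

lemma norm_sub_pow_four_le {E : Type*} [NormedAddCommGroup E] (x y : E) :
    ‖x - y‖ ^ 4 ≤ 8 * (‖x‖ ^ 4 + ‖y‖ ^ 4) := by
  have h1 : ‖x - y‖ ^ 4 ≤ (‖x‖ + ‖y‖) ^ 4 := by
    gcongr
    exact norm_sub_le x y
  have h2 := add_pow_le (norm_nonneg x) (norm_nonneg y) 4
  norm_num at h2
  linarith

/-- Bookkeeping of rates: the drift gains `μν/2`, Young's inequality with `δ = ν/16` gives back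
`μν/4`, and the noise proportional to the iterate gives back `μν/8` by the smallness of `μ`. A gain
of `μν/8` remains. The final `+ 1` keeps the constant strictly positive. -/
lemma fourth_moment_recursion_bound {μ ν Λ B S G Y X : ℝ} (hμ : 0 < μ) (hμ1 : μ ≤ 1) (hν : 0 < ν)
    (hμν : μ * ν ≤ 1) (hB : 0 ≤ B) (hS : 0 ≤ S) (hX : 0 ≤ X)
    (hμB : μ * ((64 / ν + 3) * (8 * B)) ≤ ν / 8) :
    (1 + 4 * μ * (ν / 16)) * ((1 - μ * ν / 2) * X + μ * ν / 2 * (2 * μ * Λ * G / ν) ^ 4)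
      + (4 * μ ^ 3 / (ν / 16) + 3 * μ ^ 4) * (B * (8 * (Y ^ 4 + X)) + S) ≤
    (1 - μ * ν / 8) * X
      + μ ^ 3 * (ν * (2 * Λ * G / ν) ^ 4 + (64 / ν + 3) * (8 * B * Y ^ 4 + S) + 1) := by
  set Q := (2 * Λ * G / ν) ^ 4 with hQ
  have hQ0 : 0 ≤ Q := by positivity
  set K := 64 / ν + 3 with hK
  have hK0 : 0 ≤ K := by positivity
  have e1 : (2 * μ * Λ * G / ν) ^ 4 = μ ^ 4 * Q := by rw [hQ]; ring
  have hμ0 := hμ.le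
  have h1 : (1 + 4 * μ * (ν / 16)) * ((1 - μ * ν / 2) * X) ≤ (1 - μ * ν / 4) * X := by
    have : 0 ≤ (μ * ν) ^ 2 * X := by positivity
    nlinarith
  have h2 : (1 + 4 * μ * (ν / 16)) * (μ * ν / 2 * (μ ^ 4 * Q)) ≤ μ ^ 3 * (ν * Q) := by
    have h21 : 1 + 4 * μ * (ν / 16) ≤ 2 := by linarith
    have h22 : μ ^ 5 ≤ μ ^ 3 := pow_le_pow_of_le_one hμ0 hμ1 (by norm_num)
    calc _ ≤ 2 * (μ * ν / 2 * (μ ^ 4 * Q)) := by gcongr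
      _ = μ ^ 5 * (ν * Q) := by ring
      _ ≤ _ := by gcongr
  have h3 : 4 * μ ^ 3 / (ν / 16) + 3 * μ ^ 4 ≤ μ ^ 3 * K := by
    have h31 : μ ^ 4 ≤ μ ^ 3 := pow_le_pow_of_le_one hμ0 hμ1 (by norm_num)
    have : 4 * μ ^ 3 / (ν / 16) = μ ^ 3 * (64 / ν) := by field_simp; ring
    rw [this, hK]
    linarith
  have hT : 0 ≤ B * (8 * (Y ^ 4 + X)) + S := by positivity
  have h4 := mul_le_mul_of_nonneg_right h3 hT
  have h5 : μ ^ 3 * K * (8 * B * X) ≤ μ * ν / 8 * X := by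
    have h51 : μ ^ 2 ≤ μ := by nlinarith
    calc μ ^ 3 * K * (8 * B * X) = μ ^ 2 * (μ * (K * (8 * B))) * X := by ring
      _ ≤ μ * (ν / 8) * X := by gcongr
      _ = _ := by ring
  have h6 : 0 ≤ μ ^ 3 := by positivity
  rw [e1]
  linarith

section LinearMap

variable {E : Type*} [NormedAddCommGroup E] [NormedSpace ℝ E] [FiniteDimensional ℝ E]

lemma Module.End.continuous_of_finiteDimensional (L : Module.End ℝ E) : Continuous L :=
  LinearMap.continuous_of_finiteDimensional L

lemma Module.End.comp_memLp {Ω : Type*} {m0 : MeasurableSpace Ω} {P : Measure Ω} {p : ℝ≥0∞}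
    (L : Module.End ℝ E) {w : Ω → E} (hw : MemLp w p P) : MemLp (fun ω => L (w ω)) p P :=
  (LinearMap.toContinuousLinearMap L).comp_memLp' hw

end LinearMap

/-! ### Fourth moment of the iterates. -/

section Iterates

variable {N M : ℕ} {J : Fin N → Param M → ℝ} {ν Λ : ℝ} {Ω : Type*} {m0 : MeasurableSpace Ω}
  {P : Measure Ω} [IsProbabilityMeasure P] {A : Matrix (Fin N) (Fin N) ℝ} {μ η : ℝ}
  {g : Fin N → ℕ → Ω → Param M → Param M} {w₀ : Ω → NetVec N M} {β σ β4 σ4 : Fin N → ℝ}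

lemma measurable_iterates (hJ : UniformCosts J ν Λ)
    (hg : ∀ k i, Measurable (Function.uncurry (g k i))) (hw₀ : Measurable w₀) (i : ℕ) :
    Measurable (iterates A μ η g w₀ i) := by
  induction i with
  | zero => exact hw₀
  | succ i ih =>
    rw [show iterates A μ η g w₀ (i + 1) = fun ω => _ from funext (iterates_succ_eq (J := J) i)]
    exact (Module.End.continuous_of_finiteDimensional _).measurable.comp
      ((ih.sub ((hJ.continuous_gradVec.measurable.comp ih).const_smul μ)).add
        ((measurable_noiseVec (fun k => (hJ.differentiable_gradient k).continuous) hg ih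
          (i + 1)).const_smul μ))

lemma UniformCosts.memLp_gradVec (hJ : UniformCosts J ν Λ) {p : ℝ≥0∞} {w : Ω → NetVec N M}
    (hw : MemLp w p P) : MemLp (fun ω => gradVec J (w ω)) p P := by
  refine ((memLp_const ‖gradVec J 0‖).add (hw.norm.const_mul Λ)).of_le
    (hJ.continuous_gradVec.comp_aestronglyMeasurable hw.1) (ae_of_all _ fun ω => ?_)
  have h := hJ.norm_gradVec_sub_le (w ω) 0
  rw [sub_zero] at h
  have h1 := norm_le_norm_add_norm_sub' (gradVec J (w ω)) (gradVec J 0)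
  refine le_trans ?_ (Real.le_norm_self _)
  simp only [Pi.add_apply]
  linarith

lemma memLp_iterates (hJ : UniformCosts J ν Λ)
    (hg : ∀ k i, Measurable (Function.uncurry (g k i))) (hw₀ : Measurable w₀)
    (h4 : MemLp w₀ 4 P) (hn : NoiseConditions P J g (iterates A μ η g w₀) β σ β4 σ4) (i : ℕ) :
    MemLp (iterates A μ η g w₀ i) 4 P := by
  induction i with
  | zero => exact h4
  | succ i ih =>
    rw [show iterates A μ η g w₀ (i + 1) = fun ω => _ from funext (iterates_succ_eq (J := J) i)]
    exact Module.End.comp_memLp _ ((ih.sub ((hJ.memLp_gradVec ih).const_smul μ)).add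
      ((memLp_noiseVec (measurable_iterates hJ hg hw₀)
        (fun k => (hJ.differentiable_gradient k).continuous) hg hn ih).const_smul μ))

/-- One step of the fourth moment recursion for the iterates, centred at `wη + μ ∇J(wη)`. -/
lemma fourth_moment_step (hJ : UniformCosts J ν Λ) (hA : A.IsSymm) (hμ : 0 < μ) (hμ1 : μ ≤ 1)
    (hμν : μ * ν ≤ 1) (hμΛ : μ * Λ ^ 2 ≤ ν)
    (hμB : μ * ((64 / ν + 3) * (8 * (N * ∑ k, β4 k ^ 4))) ≤ ν / 8)
    (hnn : ∀ k l, 0 ≤ (1 - (μ * η) • laplacian A : Matrix (Fin N) (Fin N) ℝ) k l)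
    {wη : NetVec N M} (hopt : gradVec J wη + η • bigLaplacian M A wη = 0)
    {G Y : ℝ} (hG : ‖gradVec J wη‖ ≤ G) (hY : ‖wη + μ • gradVec J wη‖ ≤ Y)
    (hg : ∀ k i, Measurable (Function.uncurry (g k i))) (hw₀ : Measurable w₀)
    (h4 : MemLp w₀ 4 P) (hn : NoiseConditions P J g (iterates A μ η g w₀) β σ β4 σ4) (i : ℕ) :
    ∫ ω, ‖wη + μ • gradVec J wη - iterates A μ η g w₀ (i + 1) ω‖ ^ 4 ∂P ≤
      (1 - μ * ν / 8) * ∫ ω, ‖wη + μ • gradVec J wη - iterates A μ η g w₀ i ω‖ ^ 4 ∂P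
        + μ ^ 3 * (ν * (2 * Λ * G / ν) ^ 4 + (64 / ν + 3) *
          (8 * (N * ∑ k, β4 k ^ 4) * Y ^ 4 + N * ∑ k, σ4 k ^ 4) + 1) := by
  have hν := hJ.pos_lower
  have hΛ := hJ.pos_upper
  have hJc : ∀ k, Continuous (gradient (J k)) := fun k => (hJ.differentiable_gradient k).continuous
  have hwm := measurable_iterates (A := A) (μ := μ) (η := η) hJ hg hw₀
  have hw4 := memLp_iterates hJ hg hw₀ h4 hn
  have hG0 : 0 ≤ G := (norm_nonneg _).trans hG
  set y := wη + μ • gradVec J wη with hy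
  set w := iterates A μ η g w₀ with hw
  have hz4 : ∀ i, MemLp (fun ω => y - w i ω) 4 P := fun i => (memLp_const y).sub (hw4 i)
  have iz : ∀ i, Integrable (fun ω => ‖y - w i ω‖ ^ 4) P := fun i =>
    MemLp.integrable_norm_pow (p := 4) (hz4 i) (by norm_num)
  have iw : Integrable (fun ω => ‖w i ω‖ ^ 4) P :=
    MemLp.integrable_norm_pow (p := 4) (hw4 i) (by norm_num)
  have ht4 : MemLp (fun ω => wη - w i ω + μ • gradVec J (w i ω)) 4 P :=
    ((memLp_const wη).sub (hw4 i)).add ((hJ.memLp_gradVec (hw4 i)).const_smul μ)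
  have hs4 := memLp_noiseVec hwm hJc hg hn (hw4 i)
  have htm : Measurable[pastSigma w i] fun ω => wη - w i ω + μ • gradVec J (w i ω) :=
    (measurable_const.sub (measurable_pastSigma i)).add
      ((hJ.continuous_gradVec.measurable.comp (measurable_pastSigma i)).const_smul μ)
  have h1 := integral_norm_sub_smul_pow_four_le (pastSigma_le hwm i) htm ht4 hs4
    (fun k => hn.mean k i (fun ω => w i ω k)
      ((PiLp.continuous_apply 2 _ k).measurable.comp (measurable_pastSigma i)))
    hμ.le (δ := ν / 16) (by positivity)
  have h0 : ∫ ω, ‖y - w (i + 1) ω‖ ^ 4 ∂P ≤ ∫ ω, ‖wη - w i ω + μ • gradVec J (w i ω)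
      - μ • noiseVec J g (i + 1) ω (w i ω)‖ ^ 4 ∂P := by
    refine integral_mono (iz (i + 1)) (MemLp.integrable_norm_pow (p := 4)
      (ht4.sub (hs4.const_smul μ)) (by norm_num)) fun ω => ?_
    have := center_sub_iterates_succ (g := g) (w₀ := w₀) (μ := μ) hopt i ω
    simp only [hy, hw, this]
    gcongr
    exact norm_combination_le hA hnn _
  have ht : ∫ ω, ‖wη - w i ω + μ • gradVec J (w i ω)‖ ^ 4 ∂P ≤
      (1 - μ * ν / 2) * ∫ ω, ‖y - w i ω‖ ^ 4 ∂P + μ * ν / 2 * (2 * μ * Λ * G / ν) ^ 4 := by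
    have : (1 - μ * ν / 2) * ∫ ω, ‖y - w i ω‖ ^ 4 ∂P + μ * ν / 2 * (2 * μ * Λ * G / ν) ^ 4
        = ∫ ω, ((1 - μ * ν / 2) * ‖y - w i ω‖ ^ 4
          + μ * ν / 2 * (2 * μ * Λ * G / ν) ^ 4) ∂P := by
      rw [integral_add ((iz i).const_mul _) (integrable_const _), integral_const_mul]
      simp
    rw [this]
    refine integral_mono (MemLp.integrable_norm_pow (p := 4) ht4 (by norm_num))
      (((iz i).const_mul _).add (integrable_const _)) fun ω => ?_
    refine pow_four_le_of_le_convex_comb (norm_nonneg _) (norm_nonneg _) (by positivity)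
      (by positivity) (by linarith) ?_
    refine (norm_drift_le hJ hμ.le hμν hμΛ wη (w i ω)).trans (add_le_add le_rfl ?_)
    -- The `μ²` perturbation is written as `α q` with `α = μν/2`, so that the drift bound becomes a
    -- convex combination.
    calc μ ^ 2 * (Λ * ‖gradVec J wη‖) ≤ μ ^ 2 * (Λ * G) := by gcongr
      _ = μ * ν / 2 * (2 * μ * Λ * G / ν) := by field_simp
  have hwb : ∫ ω, ‖w i ω‖ ^ 4 ∂P ≤ 8 * (Y ^ 4 + ∫ ω, ‖y - w i ω‖ ^ 4 ∂P) := by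
    have : 8 * (Y ^ 4 + ∫ ω, ‖y - w i ω‖ ^ 4 ∂P) = ∫ ω, 8 * (Y ^ 4 + ‖y - w i ω‖ ^ 4) ∂P := by
      rw [integral_const_mul, integral_add (integrable_const _) (iz i)]
      simp
    rw [this]
    refine integral_mono iw (((integrable_const _).add (iz i)).const_mul _) fun ω => ?_
    have h := norm_sub_pow_four_le y (y - w i ω)
    rw [sub_sub_cancel] at h
    refine h.trans ?_
    gcongr
  have hs : ∫ ω, ‖noiseVec J g (i + 1) ω (w i ω)‖ ^ 4 ∂P ≤
      N * (∑ k, β4 k ^ 4) * (8 * (Y ^ 4 + ∫ ω, ‖y - w i ω‖ ^ 4 ∂P)) + N * ∑ k, σ4 k ^ 4 := by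
    refine (integral_noiseVec_le hwm hJc hg hn (hw4 i)).trans ?_
    rw [mul_add, mul_assoc]
    have : 0 ≤ ∑ k, β4 k ^ 4 := Finset.sum_nonneg fun k _ => by positivity
    gcongr
  have hX : 0 ≤ ∫ ω, ‖y - w i ω‖ ^ 4 ∂P := integral_nonneg fun ω => by positivity
  refine (h0.trans h1).trans (le_trans ?_ (fourth_moment_recursion_bound hμ hμ1 hν hμν
    (mul_nonneg (Nat.cast_nonneg N) (Finset.sum_nonneg fun k _ => by positivity))
    (mul_nonneg (Nat.cast_nonneg N) (Finset.sum_nonneg fun k _ => by positivity)) hX hμB))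
  gcongr

end Iterates

/-! ### From eventual bounds to limits superior, and the square-root balance. -/

lemma limsup_toReal_sub_le {f g : ℕ → ℝ≥0∞} {B γ : ℝ} (hγ : 0 ≤ γ)
    (hf : ∀ᶠ i in atTop, f i ≤ ENNReal.ofReal B)
    (hfg : ∀ᶠ i in atTop, f i ≤ g i + ENNReal.ofReal γ)
    (hgf : ∀ᶠ i in atTop, g i ≤ f i + ENNReal.ofReal γ) :
    limsup f atTop < ⊤ ∧ limsup g atTop < ⊤ ∧
      |(limsup f atTop).toReal - (limsup g atTop).toReal| ≤ γ := by
  have hshift : ∀ {u v : ℕ → ℝ≥0∞}, (∀ᶠ i in atTop, u i ≤ v i + ENNReal.ofReal γ) →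
      limsup u atTop ≤ limsup v atTop + ENNReal.ofReal γ := fun {u v} h =>
    (limsup_le_limsup h).trans_eq (limsup_add_const atTop v (ENNReal.ofReal γ)
      (by isBoundedDefault) (by isBoundedDefault))
  have hf' : limsup f atTop < ⊤ := (limsup_le_of_le (by isBoundedDefault) hf).trans_lt
    ENNReal.ofReal_lt_top
  have hg' : limsup g atTop < ⊤ := (hshift hgf).trans_lt
    (ENNReal.add_lt_top.2 ⟨hf', ENNReal.ofReal_lt_top⟩)
  have hreal : ∀ {a b : ℝ≥0∞}, b ≠ ⊤ → a ≤ b + ENNReal.ofReal γ → a.toReal ≤ b.toReal + γ :=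
    fun {a b} hb h => by
      have := ENNReal.toReal_mono (ENNReal.add_ne_top.2 ⟨hb, ENNReal.ofReal_ne_top⟩) h
      rwa [ENNReal.toReal_add hb ENNReal.ofReal_ne_top, ENNReal.toReal_ofReal hγ] at this
  have h1 := hreal hg'.ne (hshift hfg)
  have h2 := hreal hf'.ne (hshift hgf)
  exact ⟨hf', hg', abs_le.2 ⟨by linarith, by linarith⟩⟩

/-- Factor the difference of squares, bound it by `‖x - y‖(2‖x‖ + ‖x - y‖)`, and split the mixed
term by Young's inequality with weight `r`. -/
lemma abs_norm_sq_sub_norm_sq_le {E : Type*} [NormedAddCommGroup E] {r : ℝ} (hr : 0 < r)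
    (x y : E) : |‖x‖ ^ 2 - ‖y‖ ^ 2| ≤ r * ‖x‖ ^ 2 + (1 + r⁻¹) * ‖x - y‖ ^ 2 := by
  have h1 := abs_norm_sub_norm_le x y
  have h2 : |‖x‖ ^ 2 - ‖y‖ ^ 2| = |‖x‖ - ‖y‖| * (‖x‖ + ‖y‖) := by
    rw [show ‖x‖ ^ 2 - ‖y‖ ^ 2 = (‖x‖ - ‖y‖) * (‖x‖ + ‖y‖) by ring, abs_mul,
      abs_of_nonneg (add_nonneg (norm_nonneg x) (norm_nonneg y))]
  have h3 : ‖y‖ ≤ ‖x‖ + ‖x - y‖ := by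
    have := abs_le.1 h1
    linarith [this.1]
  have hx := norm_nonneg x
  have hd := norm_nonneg (x - y)
  have h4 : |‖x‖ - ‖y‖| * (‖x‖ + ‖y‖) ≤ ‖x - y‖ * (2 * ‖x‖ + ‖x - y‖) :=
    mul_le_mul h1 (by linarith) (add_nonneg hx (norm_nonneg y)) hd
  have h5 : 0 ≤ r⁻¹ * (r * ‖x‖ - ‖x - y‖) ^ 2 := by positivity
  have h6 : r⁻¹ * (r * ‖x‖ - ‖x - y‖) ^ 2
      = r * ‖x‖ ^ 2 + r⁻¹ * ‖x - y‖ ^ 2 - 2 * ‖x‖ * ‖x - y‖ := by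
    field_simp
    ring
  rw [h2]
  nlinarith

lemma one_add_inv_sqrt_mul_le {μ C : ℝ} (hμ : 0 < μ) (hμ1 : μ ≤ 1) (hC : 0 ≤ C) :
    (1 + (√μ)⁻¹) * (C * μ ^ 2) ≤ 2 * C * (√μ * μ) := by
  have hr : 0 < √μ := Real.sqrt_pos.2 hμ
  have hrr : √μ * √μ = μ := Real.mul_self_sqrt hμ.le
  have hr1 : √μ ≤ 1 := Real.sqrt_le_one.2 hμ1
  have h1 : (√μ)⁻¹ * μ = √μ := (inv_mul_eq_iff_eq_mul₀ hr.ne').2 hrr.symm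
  have h2 : μ ≤ √μ := by nlinarith
  calc (1 + (√μ)⁻¹) * (C * μ ^ 2) = C * μ * (μ + (√μ)⁻¹ * μ) := by ring
    _ ≤ C * μ * (√μ + √μ) := by rw [h1]; gcongr
    _ = _ := by ring

/-! ### Mean-square comparison with the long-term model. -/

section Model

variable {N M : ℕ} {J : Fin N → Param M → ℝ} {ν Λ : ℝ} {Ω : Type*} {m0 : MeasurableSpace Ω}
  {P : Measure Ω} [IsProbabilityMeasure P] {A : Matrix (Fin N) (Fin N) ℝ} {μ η : ℝ}
  {g : Fin N → ℕ → Ω → Param M → Param M} {w₀ : Ω → NetVec N M} {β σ β4 σ4 : Fin N → ℝ}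

lemma IsLongTermModel.memLp (hJ : UniformCosts J ν Λ)
    (hg : ∀ k i, Measurable (Function.uncurry (g k i))) (hw₀ : Measurable w₀)
    (h4 : MemLp w₀ 4 P) (hn : NoiseConditions P J g (iterates A μ η g w₀) β σ β4 σ4)
    {wη : NetVec N M} {i₀ : ℕ} {e' : ℕ → Ω → NetVec N M}
    (he' : IsLongTermModel P A J μ η wη g (iterates A μ η g w₀) i₀ e') {i : ℕ} (hi : i₀ ≤ i) :
    MemLp (e' i) 2 P := by
  induction i, hi using Nat.le_induction with
  | base => exact he'.init
  | succ i hi ih =>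
    refine (memLp_congr_ae (he'.step i hi)).2 ?_
    have hs := (memLp_noiseVec (measurable_iterates hJ hg hw₀)
      (fun k => (hJ.differentiable_gradient k).continuous) hg hn
      (memLp_iterates hJ hg hw₀ h4 hn i)).mono_exponent (q := 4) (p := 2) (by norm_num)
    exact ((Module.End.comp_memLp _ ih).sub ((Module.End.comp_memLp _ hs).const_smul μ)).add
      (memLp_const _)

/-- One step of the mean-square recursion for the approximation error. -/
lemma IsLongTermModel.mean_square_step (hJ : UniformCosts J ν Λ) (hA : A.IsSymm) (hμ : 0 < μ)
    (hμν : μ * ν ≤ 1) (hμΛ : μ * Λ ^ 2 ≤ ν)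
    (hnn : ∀ k l, 0 ≤ (1 - (μ * η) • laplacian A : Matrix (Fin N) (Fin N) ℝ) k l)
    {wη : NetVec N M} (hopt : gradVec J wη + η • bigLaplacian M A wη = 0)
    {κ ε : ℝ} (hκ : 0 ≤ κ) (hε : 0 < ε) (hsm : HessianSmoothAt J wη κ ε)
    (hg : ∀ k i, Measurable (Function.uncurry (g k i))) (hw₀ : Measurable w₀)
    (h4 : MemLp w₀ 4 P) (hn : NoiseConditions P J g (iterates A μ η g w₀) β σ β4 σ4)
    {i₀ : ℕ} {e' : ℕ → Ω → NetVec N M}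
    (he' : IsLongTermModel P A J μ η wη g (iterates A μ η g w₀) i₀ e') {i : ℕ} (hi : i₀ ≤ i) :
    ∫ ω, ‖wη - iterates A μ η g w₀ (i + 1) ω - e' (i + 1) ω‖ ^ 2 ∂P ≤
      (1 - μ * ν / 2) * ∫ ω, ‖wη - iterates A μ η g w₀ i ω - e' i ω‖ ^ 2 ∂P
        + μ * ν / 2 * (2 * (κ + 2 * Λ / ε) / ν) ^ 2 *
          ∫ ω, ‖wη - iterates A μ η g w₀ i ω‖ ^ 4 ∂P := by
  have hν := hJ.pos_lower
  have hΛ := hJ.pos_upper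
  have he4 : ∀ j, MemLp (fun ω => wη - iterates A μ η g w₀ j ω) 4 P := fun j =>
    (memLp_const wη).sub (memLp_iterates hJ hg hw₀ h4 hn j)
  have hd : ∀ j, i₀ ≤ j → Integrable (fun ω => ‖wη - iterates A μ η g w₀ j ω - e' j ω‖ ^ 2) P :=
    fun j hj => MemLp.integrable_norm_pow (p := 2) (((he4 j).mono_exponent (by norm_num)).sub
      (he'.memLp hJ hg hw₀ h4 hn hj)) (by norm_num)
  have ie : Integrable (fun ω => ‖wη - iterates A μ η g w₀ i ω‖ ^ 4) P :=
    MemLp.integrable_norm_pow (p := 4) (he4 i) (by norm_num)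
  rw [← integral_const_mul, ← integral_const_mul,
    ← integral_add ((hd i hi).const_mul _) (ie.const_mul _)]
  refine integral_mono_ae (hd (i + 1) (by omega)) (((hd i hi).const_mul _).add (ie.const_mul _)) ?_
  filter_upwards [he'.step i hi] with ω hω
  have h := norm_error_sub_longTermStep_le (g := g) (w₀ := w₀) hJ hA hμ.le hμν hμΛ hnn hopt hκ hε
    hsm i ω (e' i ω)
  rw [← hω] at h
  -- The quadratic remainder is written as `α q` with `α = μν/2`; squaring `q` brings in the fourth
  -- power of the error.
  have h2 := sq_le_of_le_convex_comb (α := μ * ν / 2)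
    (q := 2 * (κ + 2 * Λ / ε) / ν * ‖wη - iterates A μ η g w₀ i ω‖ ^ 2) (norm_nonneg _)
    (norm_nonneg _) (by positivity) (by positivity) (by linarith)
    (h.trans_eq (by field_simp))
  refine h2.trans_eq ?_
  ring

/-- Steady-state bounds for the error of the strategy and of its long-term model, with explicit
constants. -/
lemma IsLongTermModel.eventually_moments_le (hJ : UniformCosts J ν Λ) (hA : A.IsSymm) (hμ : 0 < μ)
    (hμ1 : μ ≤ 1) (hμν : μ * ν ≤ 1) (hμΛ : μ * Λ ^ 2 ≤ ν)
    (hμB : μ * ((64 / ν + 3) * (8 * (N * ∑ k, β4 k ^ 4))) ≤ ν / 8)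
    (hnn : ∀ k l, 0 ≤ (1 - (μ * η) • laplacian A : Matrix (Fin N) (Fin N) ℝ) k l)
    {wη : NetVec N M} (hopt : gradVec J wη + η • bigLaplacian M A wη = 0)
    {G Y C₁ C₂ : ℝ} (hG : ‖gradVec J wη‖ ≤ G) (hY : ‖wη + μ • gradVec J wη‖ ≤ Y)
    (hC₁ : C₁ = ν * (2 * Λ * G / ν) ^ 4 + (64 / ν + 3) *
          (8 * (N * ∑ k, β4 k ^ 4) * Y ^ 4 + N * ∑ k, σ4 k ^ 4) + 1)
    (hC₂ : C₂ = 128 * C₁ / ν + 8 * G ^ 4)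
    {κ ε : ℝ} (hκ : 0 ≤ κ) (hε : 0 < ε) (hsm : HessianSmoothAt J wη κ ε)
    (hg : ∀ k i, Measurable (Function.uncurry (g k i))) (hw₀ : Measurable w₀)
    (h4 : MemLp w₀ 4 P) (hn : NoiseConditions P J g (iterates A μ η g w₀) β σ β4 σ4)
    {i₀ : ℕ} {e' : ℕ → Ω → NetVec N M}
    (he' : IsLongTermModel P A J μ η wη g (iterates A μ η g w₀) i₀ e') :
    (∀ᶠ i in atTop, ∫ ω, ‖wη - iterates A μ η g w₀ i ω‖ ^ 2 ∂P ≤ μ * (1 + C₂)) ∧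
    ∀ᶠ i in atTop, ∫ ω, ‖wη - iterates A μ η g w₀ i ω - e' i ω‖ ^ 2 ∂P ≤
      4 * (ν / 2 * (2 * (κ + 2 * Λ / ε) / ν) ^ 2 * C₂ + 1) / ν * μ ^ 2 := by
  have hν := hJ.pos_lower
  have hΛ := hJ.pos_upper
  have hG0 : 0 ≤ G := (norm_nonneg _).trans hG
  have hw4 := memLp_iterates hJ hg hw₀ h4 hn
  have hB0 : 0 ≤ N * ∑ k, β4 k ^ 4 :=
    mul_nonneg (Nat.cast_nonneg N) (Finset.sum_nonneg fun k _ => by positivity)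
  have hS0 : 0 ≤ N * ∑ k, σ4 k ^ 4 :=
    mul_nonneg (Nat.cast_nonneg N) (Finset.sum_nonneg fun k _ => by positivity)
  have hC₁0 : 0 < C₁ := by rw [hC₁]; positivity
  have hC₂0 : 0 ≤ C₂ := by rw [hC₂]; positivity
  have he4 : ∀ j, MemLp (fun ω => wη - iterates A μ η g w₀ j ω) 4 P := fun j =>
    (memLp_const wη).sub (hw4 j)
  have ie : ∀ j, Integrable (fun ω => ‖wη - iterates A μ η g w₀ j ω‖ ^ 4) P := fun j =>
    MemLp.integrable_norm_pow (p := 4) (he4 j) (by norm_num)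
  have ie2 : ∀ j, Integrable (fun ω => ‖wη - iterates A μ η g w₀ j ω‖ ^ 2) P := fun j =>
    MemLp.integrable_norm_pow (p := 2) ((he4 j).mono_exponent (by norm_num)) (by norm_num)
  have hz := eventually_le_of_contraction (α := μ * ν / 8) (c := μ ^ 3 * C₁)
    (u := fun i => ∫ ω, ‖wη + μ • gradVec J wη - iterates A μ η g w₀ i ω‖ ^ 4 ∂P)
    (by positivity) (by linarith) (by positivity) (Eventually.of_forall fun i => by
      rw [hC₁]
      exact fourth_moment_step hJ hA hμ hμ1 hμν hμΛ hμB hnn hopt hG hY hg hw₀ h4 hn i)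
  have he : ∀ᶠ i in atTop, ∫ ω, ‖wη - iterates A μ η g w₀ i ω‖ ^ 4 ∂P ≤ C₂ * μ ^ 2 := by
    filter_upwards [hz] with i hi
    have iz : Integrable (fun ω => ‖wη + μ • gradVec J wη - iterates A μ η g w₀ i ω‖ ^ 4) P :=
      MemLp.integrable_norm_pow (p := 4) ((memLp_const _).sub (hw4 i)) (by norm_num)
    have h1 : ∫ ω, ‖wη - iterates A μ η g w₀ i ω‖ ^ 4 ∂P ≤
        ∫ ω, 8 * (‖wη + μ • gradVec J wη - iterates A μ η g w₀ i ω‖ ^ 4 + (μ * G) ^ 4) ∂P := by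
      refine integral_mono (ie i) ((iz.add (integrable_const _)).const_mul _) fun ω => ?_
      have h := norm_sub_pow_four_le (wη + μ • gradVec J wη - iterates A μ η g w₀ i ω)
        (μ • gradVec J wη)
      rw [add_sub_right_comm, add_sub_cancel_right, norm_smul, Real.norm_of_nonneg hμ.le,
        ← add_sub_right_comm] at h
      refine h.trans ?_
      gcongr
    rw [integral_const_mul, integral_add iz (integrable_const _)] at h1
    simp only [integral_const, probReal_univ, one_smul] at h1
    have h2 : 2 * (μ ^ 3 * C₁) / (μ * ν / 8) = 16 * C₁ / ν * μ ^ 2 := by field_simp; ring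
    rw [h2] at hi
    have h3 : (μ * G) ^ 4 ≤ G ^ 4 * μ ^ 2 := by
      have : μ ^ 4 ≤ μ ^ 2 := pow_le_pow_of_le_one hμ.le hμ1 (by norm_num)
      rw [mul_pow, mul_comm]
      gcongr
    calc _ ≤ 8 * (16 * C₁ / ν * μ ^ 2 + G ^ 4 * μ ^ 2) := h1.trans (by gcongr)
      _ = _ := by rw [hC₂]; ring
  refine ⟨?_, ?_⟩
  · filter_upwards [he] with i hi
    -- The second moment follows from the fourth by `2x² ≤ μ + x⁴/μ`; the weight `μ` matches `E‖e‖⁴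
    -- = O(μ²)`.
    have h1 : ∫ ω, ‖wη - iterates A μ η g w₀ i ω‖ ^ 2 ∂P ≤
        ∫ ω, (μ + μ⁻¹ * ‖wη - iterates A μ η g w₀ i ω‖ ^ 4) ∂P := by
      refine integral_mono (ie2 i) ((integrable_const _).add ((ie i).const_mul _)) fun ω => ?_
      have h2 : 0 ≤ μ⁻¹ * (μ - ‖wη - iterates A μ η g w₀ i ω‖ ^ 2) ^ 2 := by positivity
      have h3 : μ⁻¹ * (μ - ‖wη - iterates A μ η g w₀ i ω‖ ^ 2) ^ 2
          = μ + μ⁻¹ * ‖wη - iterates A μ η g w₀ i ω‖ ^ 4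
            - 2 * ‖wη - iterates A μ η g w₀ i ω‖ ^ 2 := by
        field_simp
        ring
      have h5 : 0 ≤ ‖wη - iterates A μ η g w₀ i ω‖ ^ 2 := by positivity
      simp only
      linarith
    rw [integral_add (integrable_const _) ((ie i).const_mul _), integral_const_mul] at h1
    simp only [integral_const, probReal_univ, one_smul] at h1
    calc _ ≤ μ + μ⁻¹ * (C₂ * μ ^ 2) := h1.trans (by gcongr)
      _ = _ := by field_simp
  -- The source term is of order `μ · μ² = μ³` against a gain of order `μ`, whence the `μ²`; the
  -- recursion is available only from time `i₀` on.
  · have hd := eventually_le_of_contraction (α := μ * ν / 2)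
      (c := μ ^ 3 * (ν / 2 * (2 * (κ + 2 * Λ / ε) / ν) ^ 2 * C₂ + 1))
      (u := fun i => ∫ ω, ‖wη - iterates A μ η g w₀ i ω - e' i ω‖ ^ 2 ∂P)
      (by positivity) (by linarith) (by positivity) (by
        filter_upwards [he, eventually_ge_atTop i₀] with i hi hi₀
        refine (he'.mean_square_step hJ hA hμ hμν hμΛ hnn hopt hκ hε hsm hg hw₀ h4 hn hi₀).trans
          (add_le_add le_rfl ?_)
        have h3 : 0 ≤ μ ^ 3 := by positivity
        calc _ ≤ μ * ν / 2 * (2 * (κ + 2 * Λ / ε) / ν) ^ 2 * (C₂ * μ ^ 2) := by gcongr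
          _ ≤ _ := by linarith)
    filter_upwards [hd] with i hi
    refine hi.trans_eq ?_
    field_simp
    ring

end Model

/-! ### Choice of constants and conclusion. -/

theorem lemma1 {N M : ℕ}
    (A : Matrix (Fin N) (Fin N) ℝ) (hA : IsNetwork A)
    (J : Fin N → Param M → ℝ) (lmin lmax : Fin N → ℝ) (hJ : StronglyConvexCosts J lmin lmax)
    (κ ε : ℝ) (hκ : 0 ≤ κ) (hε : 0 < ε) (β σ β4 σ4 : Fin N → ℝ) :
    ∃ C μ₀ : ℝ, 0 < C ∧ 0 < μ₀ ∧
      ∀ μ η : ℝ, 0 < μ → μ < μ₀ → 0 ≤ η → CombinationCondition A μ η →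
      ∀ wη : NetVec N M, IsMinOn (globalCost A J η) Set.univ wη → HessianSmoothAt J wη κ ε →
      ∀ {Ω : Type*} [MeasurableSpace Ω] (P : Measure Ω) [IsProbabilityMeasure P]
        (g : Fin N → ℕ → Ω → Param M → Param M),
        (∀ k i, Measurable (Function.uncurry (g k i))) →
      ∀ w₀ : Ω → NetVec N M, Measurable w₀ → MemLp w₀ 4 P →
        NoiseConditions P J g (iterates A μ η g w₀) β σ β4 σ4 →
      ∀ (i₀ : ℕ) (e' : ℕ → Ω → NetVec N M),
        IsLongTermModel P A J μ η wη g (iterates A μ η g w₀) i₀ e' →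
      let e : ℕ → Ω → NetVec N M := fun i ω => wη - iterates A μ η g w₀ i ω
      limsupMeanSq P (fun i ω => e i ω - e' i ω) ≤ ENNReal.ofReal (C * μ ^ 2) ∧
      limsupMeanSq P e < ⊤ ∧ limsupMeanSq P e' < ⊤ ∧
      |(limsupMeanSq P e).toReal - (limsupMeanSq P e').toReal| ≤ C * μ ^ (3 / 2 : ℝ) := by
  obtain ⟨ν, Λ, hU⟩ := hJ.exists_uniformCosts
  have hν := hU.pos_lower
  have hΛ := hU.pos_upper
  set R : ℝ := ‖gradVec J 0‖ / ν with hR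
  have hR0 : 0 ≤ R := by positivity
  set G : ℝ := ‖gradVec J 0‖ + Λ * R with hG
  have hG0 : 0 ≤ G := by positivity
  set B : ℝ := N * ∑ k, β4 k ^ 4 with hB
  have hB0 : 0 ≤ B :=
    mul_nonneg (Nat.cast_nonneg N) (Finset.sum_nonneg fun k _ => by positivity)
  have hS0 : 0 ≤ N * ∑ k, σ4 k ^ 4 :=
    mul_nonneg (Nat.cast_nonneg N) (Finset.sum_nonneg fun k _ => by positivity)
  obtain ⟨C₁, hC₁⟩ : ∃ C₁, C₁ = ν * (2 * Λ * G / ν) ^ 4 + (64 / ν + 3) *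
    (8 * B * (R + G) ^ 4 + N * ∑ k, σ4 k ^ 4) + 1 := ⟨_, rfl⟩
  obtain ⟨C₂, hC₂⟩ : ∃ C₂, C₂ = 128 * C₁ / ν + 8 * G ^ 4 := ⟨_, rfl⟩
  have hC₁0 : 0 < C₁ := by rw [hC₁]; positivity
  have hC₂0 : 0 ≤ C₂ := by rw [hC₂]; positivity
  obtain ⟨C₃, hC₃⟩ : ∃ C₃, C₃ = 4 * (ν / 2 * (2 * (κ + 2 * Λ / ε) / ν) ^ 2 * C₂ + 1) / ν :=
    ⟨_, rfl⟩
  have hC₃0 : 0 < C₃ := by rw [hC₃]; positivity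
  -- Each summand of `T` encodes one smallness condition on `μ`; all are nonnegative, so `μT < 1`
  -- enforces the four conditions together.
  set T : ℝ := 1 + ν + Λ ^ 2 / ν + (64 / ν + 3) * (8 * B) * (8 / ν) with hT
  have hT0 : 0 < T := by positivity
  refine ⟨1 + C₂ + 2 * C₃, 1 / T, by positivity, by positivity, ?_⟩
  intro μ η hμ hμ₀ hη hcomb wη hmin hsm Ω _ P _ g hg w₀ hw₀ h4 hn i₀ e' he' e
  have hsymm := hA.symm
  have hμT : μ * T < 1 := (lt_div_iff₀ hT0).1 hμ₀
  have hn1 : 0 ≤ μ * ν := by positivity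
  have hn2 : 0 ≤ μ * (Λ ^ 2 / ν) := by positivity
  have hn3 : 0 ≤ μ * ((64 / ν + 3) * (8 * B) * (8 / ν)) := by positivity
  have hμsum : μ + μ * ν + μ * (Λ ^ 2 / ν) + μ * ((64 / ν + 3) * (8 * B) * (8 / ν)) < 1 := by
    rw [hT] at hμT
    linarith
  have hμ1 : μ ≤ 1 := by linarith
  have hμν : μ * ν ≤ 1 := by linarith
  have hμΛ : μ * Λ ^ 2 ≤ ν := by
    have : μ * (Λ ^ 2 / ν) ≤ 1 := by linarith
    rwa [← mul_div_assoc, div_le_one hν] at this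
  have hμB : μ * ((64 / ν + 3) * (8 * B)) ≤ ν / 8 := by
    have h1 : μ * ((64 / ν + 3) * (8 * B) * (8 / ν)) ≤ 1 := by linarith
    have h2 : μ * ((64 / ν + 3) * (8 * B) * (8 / ν)) = μ * ((64 / ν + 3) * (8 * B)) / (ν / 8) := by
      field_simp
    rwa [h2, div_le_one (by positivity)] at h1
  have hopt := gradVec_add_smul_bigLaplacian_eq_zero hU hsymm hmin
  have hwη : ‖wη‖ ≤ R :=
    norm_minimizer_le hU (eta_inner_bigLaplacian_nonneg hsymm hμ hcomb.nonneg wη) hopt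
  have hGη : ‖gradVec J wη‖ ≤ G := by
    have h1 := hU.norm_gradVec_sub_le wη 0
    rw [sub_zero] at h1
    calc _ ≤ ‖gradVec J 0‖ + ‖gradVec J wη - gradVec J 0‖ := norm_le_norm_add_norm_sub' _ _
      _ ≤ ‖gradVec J 0‖ + Λ * R := by gcongr; exact h1.trans (by gcongr)
  have hYη : ‖wη + μ • gradVec J wη‖ ≤ R + G := by
    refine (norm_add_le _ _).trans (add_le_add hwη ?_)
    rw [norm_smul, Real.norm_of_nonneg hμ.le]
    calc _ ≤ 1 * G := by gcongr
      _ = G := one_mul G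
  obtain ⟨hae, had⟩ := he'.eventually_moments_le hU hsymm hμ hμ1 hμν hμΛ hμB hcomb.nonneg hopt
    hGη hYη hC₁ hC₂ hκ hε hsm hg hw₀ h4 hn
  rw [← hC₃] at had
  have he2 : ∀ i, MemLp (e i) 2 P := fun i =>
    ((memLp_const wη).sub (memLp_iterates hU hg hw₀ h4 hn i)).mono_exponent (by norm_num)
  have he'2 : ∀ i, i₀ ≤ i → MemLp (e' i) 2 P := fun i hi => he'.memLp hU hg hw₀ h4 hn hi
  have hr : 0 < √μ := Real.sqrt_pos.2 hμ
  have hpow : μ ^ (3 / 2 : ℝ) = √μ * μ := by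
    rw [show (3 / 2 : ℝ) = 1 / 2 + 1 by norm_num, Real.rpow_add hμ, Real.rpow_one,
      ← Real.sqrt_eq_rpow]
  have hclose : ∀ᶠ i in atTop,
      |∫ ω, ‖e i ω‖ ^ 2 ∂P - ∫ ω, ‖e' i ω‖ ^ 2 ∂P| ≤ (1 + C₂ + 2 * C₃) * μ ^ (3 / 2 : ℝ) := by
    filter_upwards [hae, had, eventually_ge_atTop i₀] with i h1 h2 hi
    have i1 : Integrable (fun ω => ‖e i ω‖ ^ 2) P :=
      MemLp.integrable_norm_pow (p := 2) (he2 i) (by norm_num)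
    have i2 : Integrable (fun ω => ‖e' i ω‖ ^ 2) P :=
      MemLp.integrable_norm_pow (p := 2) (he'2 i hi) (by norm_num)
    have i3 : Integrable (fun ω => ‖e i ω - e' i ω‖ ^ 2) P :=
      MemLp.integrable_norm_pow (p := 2) ((he2 i).sub (he'2 i hi)) (by norm_num)
    -- The weight `√μ` equalizes the orders of the two terms: `√μ · μ` and `μ² / √μ`.
    have h3 : |∫ ω, ‖e i ω‖ ^ 2 ∂P - ∫ ω, ‖e' i ω‖ ^ 2 ∂P| ≤
        √μ * ∫ ω, ‖e i ω‖ ^ 2 ∂P + (1 + (√μ)⁻¹) * ∫ ω, ‖e i ω - e' i ω‖ ^ 2 ∂P := by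
      rw [← integral_sub i1 i2, ← integral_const_mul, ← integral_const_mul,
        ← integral_add (i1.const_mul _) (i3.const_mul _)]
      refine abs_integral_le_integral_abs.trans (integral_mono (i1.sub i2).abs
        ((i1.const_mul _).add (i3.const_mul _)) fun ω => ?_)
      exact abs_norm_sq_sub_norm_sq_le hr _ _
    have h4 := one_add_inv_sqrt_mul_le hμ hμ1 hC₃0.le
    calc _ ≤ √μ * (μ * (1 + C₂)) + (1 + (√μ)⁻¹) * (C₃ * μ ^ 2) := h3.trans (by gcongr)
      _ ≤ √μ * (μ * (1 + C₂)) + 2 * C₃ * (√μ * μ) := by gcongr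
      _ = _ := by rw [hpow]; ring
  have hle : (∀ i, 0 ≤ ∫ ω, ‖e i ω‖ ^ 2 ∂P) ∧ ∀ i, 0 ≤ ∫ ω, ‖e' i ω‖ ^ 2 ∂P :=
    ⟨fun i => integral_nonneg fun ω => by positivity,
      fun i => integral_nonneg fun ω => by positivity⟩
  have hγ : 0 ≤ (1 + C₂ + 2 * C₃) * μ ^ (3 / 2 : ℝ) := by positivity
  refine ⟨limsup_le_of_le (by isBoundedDefault) ?_, limsup_toReal_sub_le hγ
    (B := μ * (1 + C₂)) ?_ ?_ ?_⟩
  · filter_upwards [had, eventually_ge_atTop i₀] with i h1 hi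
    rw [lintegral_enorm_pow_eq (f := fun ω => e i ω - e' i ω) (p := 2) (by norm_num)
      ((he2 i).sub (he'2 i hi))]
    refine ENNReal.ofReal_le_ofReal (h1.trans ?_)
    gcongr
    linarith
  · filter_upwards [hae] with i h1
    rw [lintegral_enorm_pow_eq (p := 2) (by norm_num) (he2 i)]
    exact ENNReal.ofReal_le_ofReal h1
  · filter_upwards [hclose, eventually_ge_atTop i₀] with i h1 hi
    rw [lintegral_enorm_pow_eq (p := 2) (by norm_num) (he2 i),
      lintegral_enorm_pow_eq (p := 2) (by norm_num) (he'2 i hi),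
      ← ENNReal.ofReal_add (hle.2 i) hγ]
    exact ENNReal.ofReal_le_ofReal (by linarith [(abs_le.1 h1).2])
  · filter_upwards [hclose, eventually_ge_atTop i₀] with i h1 hi
    rw [lintegral_enorm_pow_eq (p := 2) (by norm_num) (he2 i),
      lintegral_enorm_pow_eq (p := 2) (by norm_num) (he'2 i hi),
      ← ENNReal.ofReal_add (hle.1 i) hγ]
    exact ENNReal.ofReal_le_ofReal (by linarith [(abs_le.1 h1).1])
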